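/- **Model ($k$-Mobile Server Problem, unweighted).** Fix $d\ge 0$, $k\ge 1$, $m_s>0$ and an initial configuration $s=(s_1,\dots,s_k)$ of $k$ servers in Euclidean space $\mathbb R^d$. Requests $r_1,\dots,r_n\in\mathbb R^d$ are revealed one by one and satisfy $d(r_t,r_{t+1})\le m_c$. In step $t$, after $r_t$ is revealed, the servers move from $x_i^{(t-1)}$ to $x_i^{(t)}$ (with $x^{(0)}=s$), and the cost of the step is $\sum_{i} d(x_i^{(t-1)},x_i^{(t)})+\min_i d(x_i^{(t)},r_t)$ (movement weight $D=1$). Offline solutions start in $s$, know all requests, and move each server by at most $m_s$ per step; $C_{Opt}$ is the infimum of their costs. The online algorithm starts in $s$ and may move each server by at most $(1+\delta)m_s$ per step, where $\delta\in(0,1)$. An online algorithm is *$\rho$-competitive* if there is a constant $\beta$, independent of the requests and of $n$, with $C_{Alg}\le\rho\, C_{Opt}+\beta$ on all admissible request sequences. **Simulated algorithm.** Let $\mathcal K$ be a deterministic online algorithm for the classical $k$-server problem in $\mathbb R^d$ with initial configuration $s$ (in every step some server has to be moved onto the request; the cost is the total distance moved). Let it be $c(\mathcal K)$-competitive, $0\le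 c(\mathcal K)<\infty$, on all request sequences, against offline $k$-server solutions starting in $s$, in the same sense (additive constant allowed). Let $c_1,\dots,c_k$ be its servers. Its *projection* $\hat{\mathcal K}$ has servers $\hat c_1,\dots,\hat c_k$, initially at $s$. Time is divided into phases: the first phase starts with the first request, and a phase started at time $t$ ends, and the next one starts, at the smallest $t'>t$ with $d(r_t,r_{t'})\ge 4k m_c$. Let $inner(r)$ be the closed ball of radius $4k m_c$ around the current request $r$. In every step, after $\mathcal K$ has moved: if $c_i\in inner(r)$ then $\hat c_i=c_i$; if $c_i\notin inner(r)$ and a phase starts in this step, then $\hat c_i$ is the point of $inner(r)$ closest to $c_i$; otherwise $\hat c_i$ does not move. **Algorithm UMS.** Let $a_1,\dots,a_k$ be the servers of the algorithm. Upon request $r'$, simulate the next step of $\hat{\mathcal K}$, which yields positions $\hat c_1',\dots,\hat c_k'$. Compute a minimum weight perfect matching (weights are distances) between $a_1,\dots,a_k$ and $\hat c_1',\dots,\hat c_k'$, and take an $i$ with $\hat c_i'=r'$. If the server matched to $\hat c_i'$ has distance at most $(1+\delta)m_s$ from $r'$, every server moves straight towards its counterpart by at most $(1+\delta)m_s$ (stopping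 there if it is reached). Otherwise a server $\tilde a$ closest to $r'$ moves straight towards $r'$ by at most $(1+\frac\delta2)m_s$ (stopping at $r'$ if it is reached), and every other server moves straight towards its counterpart by at most $(1+\delta)m_s$ (stopping there if it is reached). Ties are broken arbitrarily. **Theorem.** There is an absolute constant $C>0$ such that for all $d$, $k$, $\delta\in(0,1)$, $m_s>0$, $m_c\ge(1+\delta)m_s$, $s$ and $\mathcal K$ as above, and for every way of breaking ties, UMS is $\rho$-competitive with $$\rho = C\left(\frac{1}{\delta^4}\,k^2\,\frac{m_c}{m_s}+\frac{1}{\delta^3}\,k^2\,\frac{m_c}{m_s}\,c(\mathcal K)\right).$$ The constant $\beta$ in the competitiveness of UMS depends neither on the requests, nor on $n$, nor on the tie-breaking. -/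

import Mathlib

noncomputable section

namespace MobileServer

/-- Euclidean space of dimension `d`. -/
abbrev Pt (d : ℕ) := EuclideanSpace ℝ (Fin d)

/-- A configuration: the positions of `k` servers. -/
abbrev Config (d k : ℕ) := Fin k → Pt d

/-- The point reached from `x` by moving straight towards `y` for a distance of at most `l`,
stopping at `y` if `y` is reached. -/
def moveTowards {d : ℕ} (x y : Pt d) (l : ℝ) : Pt d :=
  if dist x y ≤ l then y else AffineMap.lineMap x y (l / dist x y)

/-! Request sequences and trajectories. A sequence of `n` requests is given by the values
`r 0, …, r (n - 1)`. A trajectory `x` has initial configuration `x 0`, and step `t` leads from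
`x t` to `x (t + 1)` after the request `r t` has been revealed. -/

/-- Total distance moved by all servers of the trajectory `x` during the first `n` steps. -/
def moveCost {d k : ℕ} (x : ℕ → Config d k) (n : ℕ) : ℝ :=
  ∑ t ∈ Finset.range n, ∑ i, dist (x t i) (x (t + 1) i)

/-- Total cost in the mobile server problem with movement weight `D`: the weighted movement, and
in every step the distance from the request to the closest server after the movement. -/
def mobileCost {d k : ℕ} (D : ℝ) (x : ℕ → Config d k) (r : ℕ → Pt d) (n : ℕ) : ℝ :=
  ∑ t ∈ Finset.range n,
    (D * ∑ i, dist (x t i) (x (t + 1) i) + ⨅ i, dist (x (t + 1) i) (r t))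

/-- Locality of requests: consecutive requests have distance at most `mc`. -/
def IsLocal {d : ℕ} (mc : ℝ) (r : ℕ → Pt d) (n : ℕ) : Prop :=
  ∀ t, t + 1 < n → dist (r t) (r (t + 1)) ≤ mc

/-- `x` is a solution of the mobile server problem over `n` steps that starts in `s` and moves
each server by at most `ms` per step. -/
def IsMobileSolution {d k : ℕ} (ms : ℝ) (s : Config d k) (x : ℕ → Config d k) (n : ℕ) : Prop :=
  x 0 = s ∧ ∀ t < n, ∀ i, dist (x t i) (x (t + 1) i) ≤ ms

/-- `x` is a solution of the (classical) `k`-server problem for the first `n` requests that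
starts in `s`: in every step some server is moved onto the request. -/
def IsKServerSolution {d k : ℕ} (s : Config d k) (x : ℕ → Config d k) (r : ℕ → Pt d) (n : ℕ) :
    Prop :=
  x 0 = s ∧ ∀ t < n, ∃ i, x (t + 1) i = r t

/-- A deterministic online algorithm for the `k`-server problem with initial configuration `s`:
the configuration after each step is a function of the requests revealed so far, and some server
is on the latest request. -/
structure KServerAlgorithm (d k : ℕ) (s : Config d k) where
  config : List (Pt d) → Config d k
  config_nil : config [] = s
  serves : ∀ (h : List (Pt d)) (p : Pt d), ∃ i, config (h ++ [p]) i = p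

/-- The configuration of the algorithm after the first `t` requests of `r`. -/
def KServerAlgorithm.run {d k : ℕ} {s : Config d k} (K : KServerAlgorithm d k s)
    (r : ℕ → Pt d) (t : ℕ) : Config d k :=
  K.config ((List.range t).map r)

/-- `K` is `c`-competitive: on every finite request sequence its cost is at most `c` times the
cost of any offline solution, up to an additive constant independent of the requests. -/
def KServerAlgorithm.IsCompetitive {d k : ℕ} {s : Config d k} (K : KServerAlgorithm d k s)
    (c : ℝ) : Prop :=
  ∃ β : ℝ, ∀ (n : ℕ) (r : ℕ → Pt d) (x : ℕ → Config d k), IsKServerSolution s x r n →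
    moveCost (K.run r) n ≤ c * moveCost x n + β

/-! The projection of a `k`-server algorithm. Time is divided into phases. -/

/-- The request at which the phase containing the request `r t` started: the first phase starts
with the first request, and a phase started at `p` ends, and the next one starts, with the first
later request at distance at least `4 * k * mc` from `p`. -/
def phaseStart {d : ℕ} (k : ℕ) (mc : ℝ) (r : ℕ → Pt d) : ℕ → Pt d
  | 0 => r 0
  | t + 1 =>
    open Classical in
    if 4 * k * mc ≤ dist (phaseStart k mc r t) (r (t + 1)) then r (t + 1)
    else phaseStart k mc r t

/-- A new phase starts with the request `r t` (and the previous one, if any, ends). -/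
def StartsPhase {d : ℕ} (k : ℕ) (mc : ℝ) (r : ℕ → Pt d) : ℕ → Prop
  | 0 => True
  | t + 1 => 4 * k * mc ≤ dist (phaseStart k mc r t) (r (t + 1))

/-- The configurations of the projected algorithm. The inner circle is the closed ball of radius
`4 * k * mc` around the current request. A simulated server inside it is copied. A server outside
is replaced, at the change of phases, by the closest point of the inner circle (the point at
distance `4 * k * mc` from the request in its direction); at all other times the projected server
does not move. -/
def KServerAlgorithm.projection {d k : ℕ} {s : Config d k} (K : KServerAlgorithm d k s)
    (mc : ℝ) (r : ℕ → Pt d) : ℕ → Config d k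
  | 0 => s
  | t + 1 => fun i =>
    open Classical in
    if dist (r t) (K.run r (t + 1) i) ≤ 4 * k * mc then K.run r (t + 1) i
    else if StartsPhase k mc r t then moveTowards (r t) (K.run r (t + 1) i) (4 * k * mc)
    else K.projection mc r t i

/-! The algorithm UMS. -/

/-- `σ` is a minimum weight perfect matching of the servers `a` with the servers `c`. -/
def IsMinMatching {d k : ℕ} (a c : Config d k) (σ : Equiv.Perm (Fin k)) : Prop :=
  ∀ τ : Equiv.Perm (Fin k), ∑ j, dist (a j) (c (σ j)) ≤ ∑ j, dist (a j) (c (τ j))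

/-- One step of UMS from the configuration `a` to `a'`, upon the request `p` and with the new
configuration `c` of the simulated algorithm. Ties (between minimum matchings, simulated servers
on the request, or closest servers) may be broken arbitrarily. -/
def IsUMSStep {d k : ℕ} (δ ms : ℝ) (a c : Config d k) (p : Pt d) (a' : Config d k) : Prop :=
  ∃ σ : Equiv.Perm (Fin k), IsMinMatching a c σ ∧ ∃ i, c (σ i) = p ∧
    ((dist (a i) p ≤ (1 + δ) * ms ∧
        ∀ j, a' j = moveTowards (a j) (c (σ j)) ((1 + δ) * ms)) ∨
      ((1 + δ) * ms < dist (a i) p ∧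
        ∃ b, (∀ j, dist (a b) p ≤ dist (a j) p) ∧
          a' b = moveTowards (a b) p ((1 + δ / 2) * ms) ∧
          ∀ j, j ≠ b → a' j = moveTowards (a j) (c (σ j)) ((1 + δ) * ms)))

/-- `a` is a run of UMS on the first `n` requests of `r`, simulating the projection of `K`. -/
def IsUMSRun {d k : ℕ} {s : Config d k} (K : KServerAlgorithm d k s) (δ ms mc : ℝ)
    (r : ℕ → Pt d) (n : ℕ) (a : ℕ → Config d k) : Prop :=
  a 0 = s ∧ ∀ t < n, IsUMSStep δ ms (a t) (K.projection mc r (t + 1)) (r t) (a (t + 1))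

/-- UMS, simulating the projection of `K` and moving servers by at most `(1 + δ) * ms` per step,
is `ρ`-competitive for the unweighted problem (`D = 1`) on `mc`-local request sequences, against
offline solutions that move servers by at most `ms` per step. -/
def UMSIsCompetitive {d k : ℕ} {s : Config d k} (K : KServerAlgorithm d k s) (δ ms mc ρ : ℝ) :
    Prop :=
  ∃ β : ℝ, ∀ (n : ℕ) (r : ℕ → Pt d), IsLocal mc r n →
    ∀ a : ℕ → Config d k, IsUMSRun K δ ms mc r n a →
      ∀ o : ℕ → Config d k, IsMobileSolution ms s o n →
        mobileCost 1 a r n ≤ ρ * mobileCost 1 o r n + β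

end MobileServer

end

noncomputable section

namespace MobileServer

/-! The cost of UMS is charged to the movement of the projected algorithm and to the offline cost.
The potential for the first charge is the minimum matching weight between UMS and the projection. It
rises by at most the projection's movement, while every step of UMS lowers it by `δ / 8` times its
own movement, and by a further `δ / 16 * ms` if the request is missed
(`IsUMSStep.matchingWeight_add_le`). Hence there are at most `16 / (δ * ms)` times the projection's
movement many misses. A miss costs at most the distance of one fixed server from the request: `2 *
B`, with `B` of order `k * mc / δ ^ 2`, plus the far cost of that server.

The far cost is bounded by a pursuit argument. The server chases targets within `12 * k * mc` of the
request at speed at least `(1 + δ / 2) * ms`; seen from far away, these targets lie almost in the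
direction of the request. As long as the offline cost is small, the request is carried by `k`
servers of speed `ms`, so it moves with speed `ms` up to one jump per server
(`dist_request_le_of_close`), and the fixed server gains on it. Otherwise the offline solution pays.
Closing a distance `x` takes about `x / (δ * ms)` steps of cost about `x`, so a potential of order
`x ^ 2 / (δ * ms)` balances the two cases (`sum_farCost_le_potential`).

Finally, the projection moves no more than the simulated algorithm, up to a start-up term and order
`k ^ 2 * mc` per later phase (`moveCost_projection_le`). Such a phase requires the request to travel
`4 * k * mc`, of which jumps between offline servers explain only `k * mc`; the offline solution
pays for the rest (`phaseCount_mul_le`). The simulated algorithm is compared with the offline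
solution whose closest server is put onto each request (`exists_kServerSolution`). -/

theorem moveTowards_eq_lineMap {d : ℕ} (x y : Pt d) {l : ℝ} (hl : 0 ≤ l) :
    ∃ c : ℝ, 0 ≤ c ∧ c ≤ 1 ∧ moveTowards x y l = AffineMap.lineMap x y c ∧
      c * dist x y = min l (dist x y) := by
  unfold moveTowards
  split_ifs with h
  · exact ⟨1, by norm_num, le_rfl, by simp, by simp [h]⟩
  · push Not at h
    have hd : 0 < dist x y := hl.trans_lt h
    exact ⟨l / dist x y, by positivity, (div_le_one hd).2 h.le, rfl, by
      rw [div_mul_cancel₀ _ hd.ne', min_eq_left h.le]⟩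

theorem dist_moveTowards_left {d : ℕ} (x y : Pt d) {l : ℝ} (hl : 0 ≤ l) :
    dist x (moveTowards x y l) = min l (dist x y) := by
  obtain ⟨c, h0, -, he, hc⟩ := moveTowards_eq_lineMap x y hl
  rw [he, dist_left_lineMap, Real.norm_of_nonneg h0, hc]

theorem dist_moveTowards_right {d : ℕ} (x y : Pt d) {l : ℝ} (hl : 0 ≤ l) :
    dist (moveTowards x y l) y = dist x y - dist x (moveTowards x y l) := by
  obtain ⟨c, h0, h1, he, hc⟩ := moveTowards_eq_lineMap x y hl
  rw [dist_moveTowards_left x y hl, he, dist_lineMap_right,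
    Real.norm_of_nonneg (sub_nonneg.2 h1), ← hc]
  ring

theorem dist_moveTowards_left_le {d : ℕ} (x y : Pt d) {l : ℝ} (hl : 0 ≤ l) :
    dist x (moveTowards x y l) ≤ l :=
  (dist_moveTowards_left x y hl).trans_le (min_le_left _ _)

/-- Moving towards a point `q` close to `p` decreases the distance to `p` at almost full speed. -/
theorem dist_moveTowards_le {d : ℕ} (x q p : Pt d) {l η : ℝ} (hl : 0 ≤ l) (hlq : l ≤ dist x q)
    (hη : 2 * dist q p ≤ η * dist x q) :
    dist (moveTowards x q l) p ≤ dist x p - l * (1 - η) := by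
  obtain ⟨c, h0, h1, he, hc⟩ := moveTowards_eq_lineMap x q hl
  rw [min_eq_left hlq] at hc
  have key : dist (moveTowards x q l) p ≤ (1 - c) * dist x p + c * dist q p := by
    rw [he, dist_eq_norm, dist_eq_norm, dist_eq_norm,
      show AffineMap.lineMap x q c - p = (1 - c) • (x - p) + c • (q - p) by
        rw [AffineMap.lineMap_apply_module]; module]
    refine (norm_add_le _ _).trans_eq ?_
    rw [norm_smul, norm_smul, Real.norm_of_nonneg h0, Real.norm_of_nonneg (sub_nonneg.2 h1)]
  have htri : dist x q ≤ dist x p + dist q p := by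
    rw [dist_comm q p]; exact dist_triangle _ _ _
  have h2 := mul_le_mul_of_nonneg_left htri h0
  have h3 := mul_le_mul_of_nonneg_left hη h0
  have h4 : c * (η * dist x q) = η * l := by rw [← hc]; ring
  rw [h4] at h3
  rw [hc] at h2
  linarith

/-! ### How far requests travel when they are served by `k` servers -/

/-- A path with steps of length at most `l` on `[t, n)`. -/
theorem dist_le_mul_of_steps {d : ℕ} {p : ℕ → Pt d} {l : ℝ} {n : ℕ}
    (hp : ∀ t, t + 1 < n → dist (p t) (p (t + 1)) ≤ l) {t s : ℕ} (hts : t ≤ s) (hs : s < n) :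
    dist (p t) (p s) ≤ ((s : ℝ) - t) * l := by
  refine (dist_le_Ico_sum_dist p hts).trans ?_
  refine (Finset.sum_le_card_nsmul _ _ l fun u hu => ?_).trans_eq ?_
  · rw [Finset.mem_Ico] at hu
    exact hp u (by omega)
  · rw [Nat.card_Ico, nsmul_eq_mul, Nat.cast_sub hts]

/-- If every request is within `Y` of some point of `S`, and these points have speed `ms`, then
the request travels with speed `ms`, apart from one jump for each point of `S`. -/
theorem dist_request_le_of_close {d k : ℕ} {ms mc Y : ℝ} {n : ℕ} {r : ℕ → Pt d}
    {o : ℕ → Config d k} (hms : 0 ≤ ms) (hmc : 0 ≤ mc) (hY : 0 ≤ Y)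
    (hr : ∀ t, t + 1 < n → dist (r t) (r (t + 1)) ≤ mc)
    (ho : ∀ t, t + 1 < n → ∀ i, dist (o t i) (o (t + 1) i) ≤ ms) (S : Finset (Fin k)) :
    ∀ t s : ℕ, t ≤ s → s < n → (∀ u, t ≤ u → u ≤ s → ∃ i ∈ S, dist (o u i) (r u) ≤ Y) →
      dist (r t) (r s) ≤ ((s : ℝ) - t) * ms + S.card * (2 * Y + mc) := by
  classical
  induction hS : S.card generalizing S with
  | zero =>
    intro t s hts _ h
    obtain ⟨i, hi, -⟩ := h t le_rfl hts
    rw [Finset.card_eq_zero] at hS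
    simp [hS] at hi
  | succ m ih =>
    intro t s hts hs h
    obtain ⟨i, hi, hit⟩ := h t le_rfl hts
    let P : ℕ → Prop := fun u => t ≤ u ∧ dist (o u i) (r u) ≤ Y
    have hPt : P t := ⟨le_rfl, hit⟩
    -- The server `i` carries the request from `t` to its last close time `τ`. After `τ` it is never
    -- close again, so the induction continues with `S.erase i`, at the price of one request step.
    set τ := Nat.findGreatest P s with hτ
    have hτs : τ ≤ s := Nat.findGreatest_le s
    obtain ⟨htτ, hτY⟩ : P τ := Nat.findGreatest_spec hts hPt
    have hmove : dist (o t i) (o τ i) ≤ ((τ : ℝ) - t) * ms :=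
      dist_le_mul_of_steps (p := fun u => o u i) (fun u hu => ho u hu i) htτ (by omega)
    have h1 : dist (r t) (r τ) ≤ ((τ : ℝ) - t) * ms + 2 * Y := by
      have := dist_triangle4 (r t) (o t i) (o τ i) (r τ)
      rw [dist_comm (r t) (o t i)] at this
      linarith
    rcases hτs.eq_or_lt with heq | hlt
    · rw [heq] at h1
      have : 0 ≤ (m : ℝ) * (2 * Y + mc) := by positivity
      push_cast
      nlinarith
    · have h2 := ih (S.erase i) (by rw [Finset.card_erase_of_mem hi, hS]; rfl) (τ + 1) s hlt hs
        (fun u hu hus => by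
          obtain ⟨j, hj, hju⟩ := h u (by omega) hus
          refine ⟨j, Finset.mem_erase.2 ⟨?_, hj⟩, hju⟩
          rintro rfl
          exact Nat.findGreatest_is_greatest (P := P) (n := s) hu hus ⟨by omega, hju⟩)
      have h3 := hr τ (by omega)
      have h4 := dist_triangle4 (r t) (r τ) (r (τ + 1)) (r s)
      push_cast at h2 ⊢
      nlinarith

/-- The distance travelled by the requests is bounded by the cost of serving them, apart from one
jump of length `mc` for each server. -/
theorem dist_request_le_cost {d k : ℕ} {mc : ℝ} {n : ℕ} {r : ℕ → Pt d}
    {o : ℕ → Config d k} {h : ℕ → ℝ} (hmc : 0 ≤ mc) (hh : ∀ t, 0 ≤ h t)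
    (hr : ∀ t, t + 1 < n → dist (r t) (r (t + 1)) ≤ mc) (S : Finset (Fin k)) :
    ∀ t s : ℕ, t ≤ s → s < n → (∀ u, t ≤ u → u ≤ s → ∃ i ∈ S, dist (o u i) (r u) ≤ h u) →
      dist (r t) (r s) ≤ ∑ u ∈ Finset.Ico t s, ∑ i ∈ S, dist (o u i) (o (u + 1) i)
        + 2 * ∑ u ∈ Finset.Ico t (s + 1), h u + S.card * mc := by
  classical
  induction hS : S.card generalizing S with
  | zero =>
    intro t s hts _ h
    obtain ⟨i, hi, -⟩ := h t le_rfl hts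
    rw [Finset.card_eq_zero] at hS
    simp [hS] at hi
  | succ m ih =>
    intro t s hts hs hser
    obtain ⟨i, hi, hit⟩ := hser t le_rfl hts
    let P : ℕ → Prop := fun u => t ≤ u ∧ dist (o u i) (r u) ≤ h u
    have hPt : P t := ⟨le_rfl, hit⟩
    set τ := Nat.findGreatest P s with hτ
    have hτs : τ ≤ s := Nat.findGreatest_le s
    obtain ⟨htτ, hτY⟩ : P τ := Nat.findGreatest_spec hts hPt
    have hmove := dist_le_Ico_sum_dist (fun u => o u i) htτ
    have h1 : dist (r t) (r τ) ≤ h t + ∑ u ∈ Finset.Ico t τ, dist (o u i) (o (u + 1) i) + h τ := by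
      have := dist_triangle4 (r t) (o t i) (o τ i) (r τ)
      rw [dist_comm (r t) (o t i)] at this
      linarith
    have hsub : ∑ u ∈ Finset.Ico t τ, dist (o u i) (o (u + 1) i) ≤
        ∑ u ∈ Finset.Ico t s, dist (o u i) (o (u + 1) i) :=
      Finset.sum_le_sum_of_subset_of_nonneg (Finset.Ico_subset_Ico_right hτs)
        fun _ _ _ => dist_nonneg
    -- The factor 2 is needed for `τ = t`, where both ends are the same summand.
    have hends : h t + h τ ≤ 2 * ∑ u ∈ Finset.Ico t (τ + 1), h u := by
      have e1 := Finset.single_le_sum (f := h) (fun u _ => hh u)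
        (Finset.mem_Ico.2 ⟨le_rfl, Nat.lt_succ_of_le htτ⟩ : t ∈ Finset.Ico t (τ + 1))
      have e2 := Finset.single_le_sum (f := h) (fun u _ => hh u)
        (Finset.mem_Ico.2 ⟨htτ, Nat.lt_succ_self τ⟩ : τ ∈ Finset.Ico t (τ + 1))
      linarith
    have hsplit : ∀ u, ∑ j ∈ S, dist (o u j) (o (u + 1) j) =
        dist (o u i) (o (u + 1) i) + ∑ j ∈ S.erase i, dist (o u j) (o (u + 1) j) :=
      fun u => (Finset.add_sum_erase S _ hi).symm
    simp only [hsplit, Finset.sum_add_distrib]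
    rcases hτs.eq_or_lt with heq | hlt
    · rw [heq] at h1 hends
      have : 0 ≤ (m : ℝ) * mc := by positivity
      have : 0 ≤ ∑ u ∈ Finset.Ico t s, ∑ j ∈ S.erase i, dist (o u j) (o (u + 1) j) :=
        Finset.sum_nonneg fun _ _ => Finset.sum_nonneg fun _ _ => dist_nonneg
      push_cast
      linarith
    · have h2 := ih (S.erase i) (by rw [Finset.card_erase_of_mem hi, hS]; rfl) (τ + 1) s hlt hs
        (fun u hu hus => by
          obtain ⟨j, hj, hju⟩ := hser u (by omega) hus
          refine ⟨j, Finset.mem_erase.2 ⟨?_, hj⟩, hju⟩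
          rintro rfl
          exact Nat.findGreatest_is_greatest (P := P) (n := s) hu hus ⟨by omega, hju⟩)
      have h3 := hr τ (by omega)
      have h4 := dist_triangle4 (r t) (r τ) (r (τ + 1)) (r s)
      have h5 : ∑ u ∈ Finset.Ico (τ + 1) s, ∑ j ∈ S.erase i, dist (o u j) (o (u + 1) j) ≤
          ∑ u ∈ Finset.Ico t s, ∑ j ∈ S.erase i, dist (o u j) (o (u + 1) j) :=
        Finset.sum_le_sum_of_subset_of_nonneg (Finset.Ico_subset_Ico_left (by omega))
          fun _ _ _ => Finset.sum_nonneg fun _ _ => dist_nonneg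
      have h6 := Finset.sum_Ico_consecutive h (show t ≤ τ + 1 by omega)
        (show τ + 1 ≤ s + 1 by omega)
      push_cast
      linarith

/-! ### Pursuit of the requests by a faster server -/

/-- A server `p` with speed between `(1 + δ / 2) * ms` and `2 * ms` that follows requests `r` with
speed `mc`, up to an error of `12 * k * mc` in its target. The requests are served by `k` servers
`o` with speed `ms`, at cost `h`. -/
structure IsPursuit {d k : ℕ} (δ ms mc : ℝ) (n : ℕ) (p r : ℕ → Pt d) (o : ℕ → Config d k)
    (h : ℕ → ℝ) : Prop where
  servers_pos : 0 < k
  delta_pos : 0 < δ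
  delta_lt : δ < 1
  speed_pos : 0 < ms
  speed_le : ms ≤ mc
  request_step : ∀ t, t + 1 < n → dist (r t) (r (t + 1)) ≤ mc
  offline_step : ∀ t, t + 1 < n → ∀ i, dist (o t i) (o (t + 1) i) ≤ ms
  chase : ∀ t, t + 1 < n → ∃ q l, dist q (r (t + 1)) ≤ 12 * k * mc ∧ (1 + δ / 2) * ms ≤ l ∧
    l ≤ 2 * ms ∧ p (t + 1) = moveTowards (p t) q l
  cost_eq : ∀ t, h t = ⨅ i, dist (o t i) (r t)

namespace IsPursuit

variable {d k : ℕ} {δ ms mc : ℝ} {n : ℕ} {p r : ℕ → Pt d} {o : ℕ → Config d k} {h : ℕ → ℝ}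

theorem cost_nonneg (H : IsPursuit δ ms mc n p r o h) (t : ℕ) : 0 ≤ h t := by
  rw [H.cost_eq]
  exact Real.iInf_nonneg fun _ => dist_nonneg

theorem exists_cost_eq (H : IsPursuit δ ms mc n p r o h) (t : ℕ) :
    ∃ i, dist (o t i) (r t) = h t := by
  have := Fin.pos_iff_nonempty.1 H.servers_pos
  rw [H.cost_eq]
  exact exists_eq_ciInf_of_finite

theorem cost_le (H : IsPursuit δ ms mc n p r o h) (t : ℕ) (i : Fin k) :
    h t ≤ dist (o t i) (r t) := by
  rw [H.cost_eq]
  exact ciInf_le (Set.finite_range _).bddBelow i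

/-- In one step the request moves by at most `mc` and an offline server by at most `ms ≤ mc`. A
large offline cost therefore persists for some time. -/
theorem cost_sub_le (H : IsPursuit δ ms mc n p r o h) {t s : ℕ} (hts : t ≤ s) (hs : s < n) :
    h t - ((s : ℝ) - t) * (2 * mc) ≤ h s := by
  obtain ⟨i, hi⟩ := H.exists_cost_eq s
  have h1 := dist_le_mul_of_steps H.request_step hts hs
  have h2 := dist_le_mul_of_steps (p := fun u => o u i) (fun u hu => H.offline_step u hu i) hts hs
  have h3 := H.cost_le t i
  have h4 := dist_triangle4 (o t i) (o s i) (r s) (r t)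
  rw [dist_comm (r s) (r t)] at h4
  have h5 : 0 ≤ (s : ℝ) - t := sub_nonneg.2 (Nat.cast_le.2 hts)
  have h6 := mul_le_mul_of_nonneg_left H.speed_le h5
  linarith

theorem server_step (H : IsPursuit δ ms mc n p r o h) {t : ℕ} (ht : t + 1 < n) :
    dist (p t) (p (t + 1)) ≤ 2 * ms := by
  obtain ⟨q, l, -, hl, hl', hp⟩ := H.chase t ht
  have h0 : 0 ≤ l := le_trans (mul_nonneg (by linarith [H.delta_pos]) H.speed_pos.le) hl
  rw [hp]
  exact (dist_moveTowards_left_le _ _ h0).trans hl'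

theorem dist_server_le (H : IsPursuit δ ms mc n p r o h) {t s : ℕ} (hts : t ≤ s) (hs : s < n) :
    dist (p t) (p s) ≤ ((s : ℝ) - t) * (2 * ms) :=
  dist_le_mul_of_steps (p := p) (l := 2 * ms) (fun _ hu => H.server_step hu) hts hs

theorem dist_le_add (H : IsPursuit δ ms mc n p r o h) {t s : ℕ} (hts : t ≤ s) (hs : s < n) :
    dist (p s) (r s) ≤ dist (p t) (r t) + ((s : ℝ) - t) * (3 * mc) := by
  have h1 := H.dist_server_le hts hs
  have h2 := dist_le_mul_of_steps H.request_step hts hs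
  have h3 := dist_triangle4 (p s) (p t) (r t) (r s)
  rw [dist_comm (p s) (p t)] at h3
  have h5 : 0 ≤ (s : ℝ) - t := sub_nonneg.2 (Nat.cast_le.2 hts)
  have h6 := mul_le_mul_of_nonneg_left H.speed_le h5
  linarith

theorem dist_request_le (H : IsPursuit δ ms mc n p r o h) {Y : ℝ} (hY : 0 ≤ Y) {t s : ℕ}
    (hts : t ≤ s) (hs : s < n) (hh : ∀ u, t ≤ u → u ≤ s → h u ≤ Y) :
    dist (r t) (r s) ≤ ((s : ℝ) - t) * ms + k * (2 * Y + mc) := by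
  have := dist_request_le_of_close H.speed_pos.le (H.speed_pos.le.trans H.speed_le) hY
    H.request_step H.offline_step Finset.univ t s hts hs fun u hu hus => by
      obtain ⟨i, hi⟩ := H.exists_cost_eq u
      exact ⟨i, Finset.mem_univ i, hi.trans_le (hh u hu hus)⟩
  rwa [Finset.card_univ, Fintype.card_fin] at this

theorem mc_le (H : IsPursuit δ ms mc n p r o h) : mc ≤ k * mc :=
  le_mul_of_one_le_left (H.speed_pos.le.trans H.speed_le) (Nat.one_le_cast.2 H.servers_pos)

/-- If the offline cost is small in a window, the server approaches the request. -/
theorem dist_le_sub (H : IsPursuit δ ms mc n p r o h) {Y w : ℝ} (hY : 0 ≤ Y) {t u : ℕ}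
    (htu : t ≤ u) (hu : u < n) (hw : 128 * w = δ * dist (p t) (r t)) (hkw : 12 * k * mc ≤ w)
    (hYw : k * (2 * Y + mc) ≤ w / 8) (huw : ((u : ℝ) - t) * ms ≤ 2 * w)
    (hh : ∀ v, t ≤ v → v ≤ u → h v ≤ Y) :
    dist (p u) (r u) ≤ dist (p t) (r t) - ((u : ℝ) - t) * (δ / 4 * ms) + k * (2 * Y + mc) := by
  have hms := H.speed_pos
  have hmc := hms.trans_le H.speed_le
  have hδ := H.delta_pos
  have hδ1 := H.delta_lt
  have hk := H.mc_le
  have hwD : 128 * w ≤ dist (p t) (r t) := by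
    rw [hw]; exact mul_le_of_le_one_left dist_nonneg hδ1.le
  -- Progress is measured towards the last request `r u` of the window. All targets stay within `4 *
  -- w` of it, while the server stays at least half its initial distance away from them.
  have claim : ∀ v, t ≤ v → v ≤ u →
      dist (p v) (r u) ≤ dist (p t) (r u) - ((v : ℝ) - t) * ((1 + δ / 4) * ms) := by
    intro v htv
    induction v, htv using Nat.le_induction with
    | base => intro _; simp
    | succ v htv ih =>
      intro hvu
      have ih := ih (by omega)
      obtain ⟨q, l, hq, hl, hl', hp⟩ := H.chase v (by omega)
      have e0 : (t : ℝ) ≤ v := Nat.cast_le.2 htv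
      have e1 : (v : ℝ) + 1 ≤ u := by exact_mod_cast hvu
      have e2 := H.dist_server_le htv (by omega)
      have e3 := H.dist_request_le hY (show t ≤ v + 1 by omega) (by omega)
        fun x hx hx' => hh x hx (by omega)
      have e4 := H.dist_request_le hY hvu hu fun x hx hx' => hh x (by omega) hx'
      have e5 : ((v : ℝ) - t) * ms ≤ ((u : ℝ) - t) * ms :=
        mul_le_mul_of_nonneg_right (by linarith) hms.le
      have e6 : ((v : ℝ) + 1 - t) * ms ≤ ((u : ℝ) - t) * ms :=
        mul_le_mul_of_nonneg_right (by linarith) hms.le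
      have e7 : ((u : ℝ) - (v + 1)) * ms ≤ ((u : ℝ) - t) * ms :=
        mul_le_mul_of_nonneg_right (by linarith) hms.le
      push_cast at e3 e4
      have hqu : dist q (r u) ≤ 4 * w := by
        have := dist_triangle q (r (v + 1)) (r u)
        linarith
      have hpq : dist (p t) (r t) / 2 ≤ dist (p v) q := by
        have f1 := dist_triangle4 (p t) (p v) q (r t)
        have f2 := dist_triangle q (r (v + 1)) (r t)
        rw [dist_comm (r (v + 1)) (r t)] at f2
        linarith
      -- Here `2 * (4 * w)` equals `δ / 16 * dist (p t) (r t)`; this is the reason for the 128 in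
      -- `hw`.
      have hη : 2 * dist q (r u) ≤ δ / 8 * dist (p v) q := by
        have := mul_le_mul_of_nonneg_left hpq hδ.le
        linarith
      have h0 : 0 ≤ l := le_trans (mul_nonneg (by linarith) hms.le) hl
      have hmsw : ms ≤ w := by linarith [H.speed_le]
      have key := dist_moveTowards_le (p v) q (r u) h0 (by linarith) hη
      rw [← hp] at key
      have hll : (1 + δ / 4) * ms ≤ l * (1 - δ / 8) := by
        have g1 := mul_le_mul_of_nonneg_right hl (show 0 ≤ 1 - δ / 8 by linarith)
        have g2 : 0 ≤ ms * δ * (1 - δ) := by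
          have := sub_pos.2 hδ1
          positivity
        have g3 : 0 ≤ ms * δ := by positivity
        nlinarith
      push_cast
      linarith
  have h1 := claim u htu le_rfl
  have h2 := H.dist_request_le hY htu hu hh
  -- The request's own drift of `ms` per step leaves a gain of `δ / 4 * ms` per step, minus the
  -- jumps.
  have h3 := dist_triangle (p t) (r t) (r u)
  linarith

/-! ### The truncated quadratic potential -/

/-- The potential of a distance `x`, with threshold `B`. -/
def potential (A B x : ℝ) : ℝ := A * max 0 (x ^ 2 - (3 / 2 * B) ^ 2)

theorem potential_nonneg {A : ℝ} (hA : 0 ≤ A) (B x : ℝ) : 0 ≤ potential A B x :=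
  mul_nonneg hA (le_max_left _ _)

theorem potential_eq_zero {A B x : ℝ} (hx : 0 ≤ x) (hxB : x ≤ 3 / 2 * B) :
    potential A B x = 0 := by
  rw [potential, max_eq_left, mul_zero]
  nlinarith

theorem potential_le_of_le {A B x y : ℝ} (hA : 0 ≤ A) (hx : 0 ≤ x) (hxy : x ≤ y) :
    potential A B x ≤ potential A B y := by
  unfold potential
  gcongr

theorem potential_le_add {A B x y : ℝ} (hA : 0 ≤ A) (hx : 0 ≤ x) (hxy : x ≤ y) :
    potential A B y ≤ potential A B x + A * (y ^ 2 - x ^ 2) := by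
  unfold potential
  rw [← mul_add]
  refine mul_le_mul_of_nonneg_left (max_le ?_ ?_) hA
  · have := le_max_left 0 (x ^ 2 - (3 / 2 * B) ^ 2)
    nlinarith
  · have := le_max_right 0 (x ^ 2 - (3 / 2 * B) ^ 2)
    linarith

/-- Truncation removes at most two thirds of `x ^ 2`, since `(3 / 2) ^ 2 < 2 / 3 * (19 / 10) ^ 2`.
-/
theorem le_potential {A B x : ℝ} (hA : 0 ≤ A) (hB : 0 ≤ B) (hx : 19 / 10 * B ≤ x) :
    A * (x ^ 2 / 3) ≤ potential A B x := by
  refine mul_le_mul_of_nonneg_left (le_max_of_le_right ?_) hA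
  nlinarith

/-- Either `y` falls below the truncation and the whole potential of `x` is released, or the squares
differ without truncation. -/
theorem potential_add_le {A B x y : ℝ} (hA : 0 ≤ A) (hB : 0 ≤ B) (hy : 0 ≤ y)
    (hx : 19 / 10 * B ≤ x) :
    potential A B y + A * min (x ^ 2 / 3) (x ^ 2 - y ^ 2) ≤ potential A B x := by
  rcases le_total y (3 / 2 * B) with h | h
  · rw [potential_eq_zero hy h, zero_add]
    exact (mul_le_mul_of_nonneg_left (min_le_left _ _) hA).trans (le_potential hA hB hx)
  · unfold potential
    rw [← mul_add]
    refine mul_le_mul_of_nonneg_left (le_max_of_le_right ?_) hA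
    rw [max_eq_right (by nlinarith)]
    linarith [min_le_right (x ^ 2 / 3) (x ^ 2 - y ^ 2)]

/-! ### Costs within a window -/

/-- The distance of the server, where it exceeds `2 * B`. -/
def farCost (B : ℝ) (p r : ℕ → Pt d) (t : ℕ) : ℝ :=
  if 2 * B < dist (p t) (r t) then dist (p t) (r t) else 0

theorem farCost_nonneg (B : ℝ) (p r : ℕ → Pt d) (t : ℕ) : 0 ≤ farCost B p r t := by
  unfold farCost
  split_ifs
  · exact dist_nonneg
  · exact le_rfl

theorem farCost_le (B : ℝ) (p r : ℕ → Pt d) (t : ℕ) : farCost B p r t ≤ dist (p t) (r t) := by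
  unfold farCost
  split_ifs
  · exact le_rfl
  · exact dist_nonneg

theorem ceil_mul_le {x y : ℝ} (hx : 0 ≤ x) (hy : 0 < y) : (⌈x / y⌉₊ : ℝ) * y ≤ x + y := by
  have h1 := (Nat.ceil_lt_add_one (div_nonneg hx hy.le)).le
  have h2 := mul_le_mul_of_nonneg_right h1 hy.le
  rwa [add_mul, div_mul_cancel₀ _ hy.ne', one_mul] at h2

theorem le_ceil_mul {x y : ℝ} (hy : 0 < y) : x ≤ (⌈x / y⌉₊ : ℝ) * y := by
  have h2 := mul_le_mul_of_nonneg_right (Nat.le_ceil (x / y)) hy.le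
  rwa [div_mul_cancel₀ _ hy.ne'] at h2

/-- In a window that ends soon after the first time with large offline cost, the distance to the
request does not increase much. -/
theorem dist_le_of_window (H : IsPursuit δ ms mc n p r o h) {Y w : ℝ} (hY : 0 ≤ Y) {t s v : ℕ}
    (hmcw : mc ≤ w / 16) (hYw : Y ≤ w / 32) (hkY : k * (2 * Y + mc) ≤ w / 8)
    (hts : t ≤ s) (hsw : s ≤ t + ⌈w / ms⌉₊) (hh : ∀ x, t ≤ x → x < s → h x ≤ Y)
    (htv : t ≤ v) (hvs : v ≤ s + ⌈Y / (4 * mc)⌉₊) (hv : v < n) :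
    dist (p v) (r v) ≤ dist (p t) (r t) + 4 * w := by
  have hms := H.speed_pos
  have hmc := hms.trans_le H.speed_le
  have hw : 0 ≤ w := by linarith
  have hW := ceil_mul_le hw hms
  have hm := ceil_mul_le hY (show 0 < 4 * mc by linarith)
  set W := ⌈w / ms⌉₊
  set m := ⌈Y / (4 * mc)⌉₊
  have hreq : ∀ x, t ≤ x → x ≤ s → x < n →
      dist (r t) (r x) ≤ ((x : ℝ) - t) * ms + w / 8 + mc := by
    intro x htx hxs hxn
    rcases htx.eq_or_lt with rfl | hlt
    · rw [dist_self]
      have : 0 ≤ ((t : ℝ) - t) * ms := by simp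
      linarith
    · obtain ⟨x, rfl⟩ : ∃ y, x = y + 1 := ⟨x - 1, by omega⟩
      have h1 := H.dist_request_le hY (show t ≤ x by omega) (by omega)
        fun y hy hyx => hh y hy (by omega)
      have h2 := H.request_step x hxn
      have h3 := dist_triangle (r t) (r x) (r (x + 1))
      push_cast
      linarith
  obtain ⟨x, htx, hxs, hxv, hvx⟩ : ∃ x, t ≤ x ∧ x ≤ s ∧ x ≤ v ∧ v ≤ x + m :=
    ⟨min v s, by omega, by omega, by omega, by omega⟩
  have h1 := hreq x htx hxs (by omega)
  have h2 := dist_le_mul_of_steps H.request_step hxv hv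
  have h3 := H.dist_server_le htv hv
  have c1 : (x : ℝ) - t ≤ W := by
    have : (x : ℝ) ≤ t + W := by exact_mod_cast hxs.trans hsw
    linarith
  have c2 : (v : ℝ) - x ≤ m := by
    have : (v : ℝ) ≤ x + m := by exact_mod_cast hvx
    linarith
  have m1 := mul_le_mul_of_nonneg_right c1 hms.le
  have m2 := mul_le_mul_of_nonneg_right c2 hmc.le
  have m3 : (m : ℝ) * ms ≤ m * mc := mul_le_mul_of_nonneg_left H.speed_le (Nat.cast_nonneg m)
  have m4 := mul_le_mul_of_nonneg_right c2 hms.le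
  have h4 := dist_triangle4 (p v) (p t) (r t) (r v)
  rw [dist_comm (p v) (p t)] at h4
  have h5 := dist_triangle (r t) (r x) (r v)
  have := H.speed_le
  linarith

/-- There are at most `5 / 4 * w / ms` steps of cost at most `33 / 32 * D` each, and `5 / 4 * 33 /
32 < 13 / 10`. -/
theorem sum_farCost_le {B D w : ℝ} {t u N : ℕ} (hms : 0 < ms) (hw : 0 ≤ w)
    (hwD : 128 * w ≤ D) (hu : (u : ℝ) - t ≤ N) (hN : (N : ℝ) * ms ≤ 5 / 4 * w) (htu : t ≤ u)
    (hE : ∀ v, t ≤ v → v < u → dist (p v) (r v) ≤ D + 4 * w) :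
    ∑ v ∈ Finset.Ico t u, farCost B p r v ≤ 13 / 10 * (w * D / ms) := by
  calc _ ≤ ∑ v ∈ Finset.Ico t u, (D + 4 * w) := Finset.sum_le_sum fun v hv => by
        rw [Finset.mem_Ico] at hv
        exact (farCost_le B p r v).trans (hE v hv.1 hv.2)
    _ = ((u : ℝ) - t) * (D + 4 * w) := by
        rw [Finset.sum_const, Nat.card_Ico, nsmul_eq_mul, Nat.cast_sub htu]
    _ ≤ (5 / 4 * w / ms) * (D + 4 * w) := by
        refine mul_le_mul_of_nonneg_right (hu.trans ?_) (by linarith)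
        rwa [le_div_iff₀ hms]
    _ = 5 / 4 * (w * (D + 4 * w)) / ms := by ring
    _ ≤ 13 / 10 * (w * D) / ms := by
        refine div_le_div_of_nonneg_right ?_ hms.le
        nlinarith
    _ = _ := by ring

/-- Since `4 * w ≤ D / 32`, a window that starts below `19 / 10 * B` never exceeds `2 * B`. So far
cost arises only in windows where `le_potential` applies. -/
theorem sum_farCost_eq_zero {B D w : ℝ} {t u : ℕ} (hwD : 128 * w ≤ D) (hD : D ≤ 19 / 10 * B)
    (hw : 0 ≤ w) (hE : ∀ v, t ≤ v → v < u → dist (p v) (r v) ≤ D + 4 * w) :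
    ∑ v ∈ Finset.Ico t u, farCost B p r v = 0 := by
  refine Finset.sum_eq_zero fun v hv => ?_
  rw [Finset.mem_Ico] at hv
  rw [farCost, if_neg]
  have := hE v hv.1 hv.2
  linarith

/-- An offline cost of `Y` decreases by at most `2 * mc` per step, hence stays above `Y / 2` for `⌈Y
/ (4 * mc)⌉₊` steps. -/
theorem mul_sq_le_sum_cost (H : IsPursuit δ ms mc n p r o h) {Y : ℝ} (hY : 0 ≤ Y) {s : ℕ}
    (hs : Y ≤ h s) (hsn : s + ⌈Y / (4 * mc)⌉₊ ≤ n) :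
    Y ^ 2 / (8 * mc) ≤ ∑ v ∈ Finset.Ico s (s + ⌈Y / (4 * mc)⌉₊), h v := by
  have hmc := H.speed_pos.trans_le H.speed_le
  have hm := le_ceil_mul (x := Y) (show 0 < 4 * mc by linarith)
  have hlt : ∀ j : ℕ, j < ⌈Y / (4 * mc)⌉₊ → (j : ℝ) * (4 * mc) ≤ Y := fun j hj => by
    rw [Nat.lt_ceil, lt_div_iff₀ (by linarith)] at hj
    exact hj.le
  set m := ⌈Y / (4 * mc)⌉₊
  calc Y ^ 2 / (8 * mc) ≤ m * (Y / 2) := by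
        rw [div_le_iff₀ (by linarith)]
        nlinarith
    _ = ∑ v ∈ Finset.Ico s (s + m), Y / 2 := by simp
    _ ≤ _ := Finset.sum_le_sum fun v hv => by
        rw [Finset.mem_Ico] at hv
        have h1 := H.cost_sub_le hv.1 (by omega)
        have h2 := hlt (v - s) (by omega)
        rw [Nat.cast_sub hv.1] at h2
        linarith

/-- The threshold above which the server is far from the request. -/
def farThreshold (k : ℕ) (δ mc : ℝ) : ℝ := 2048 * (k * mc / δ ^ 2)

/-- The competitive ratio for the cost of the server where it is far from the request. -/
def farRatio (k : ℕ) (δ ms mc : ℝ) : ℝ := 2 ^ 28 * (1 / δ ^ 4 * (k : ℝ) ^ 2 * (mc / ms))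

/-- This settles a window with large offline cost: the growth of the potential and the window's far
cost are paid by the offline solution. All terms are multiples of `w ^ 2 / (δ ^ 2 * ms)`, with
coefficients `24576 + 384 * δ` and `13 / 10 * 128 * δ` against 32768. As `Y` is of order `δ * w /
k`, the factor `k ^ 2 / δ ^ 4` of the ratio arises here. -/
theorem far_ratio_bound {w D Y : ℝ} (hk : 0 < k) (hδ : 0 < δ) (hδ1 : δ < 1) (hms : 0 < ms)
    (hmc : 0 < mc) (hwD : 128 * w = δ * D) (hY : Y = δ * w / (32 * k)) :
    24 / (δ * ms) * ((D + 4 * w) ^ 2 - D ^ 2) + 13 / 10 * (w * D / ms) ≤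
      farRatio k δ ms mc * (Y ^ 2 / (8 * mc)) := by
  have hk' : (0 : ℝ) < k := Nat.cast_pos.2 hk
  have hD : D = 128 * w / δ := by
    rw [hwD]
    field_simp
  have e1 : farRatio k δ ms mc * (Y ^ 2 / (8 * mc)) = 32768 * (w ^ 2 / (δ ^ 2 * ms)) := by
    rw [hY, farRatio]
    field_simp
    ring
  have e2 : 24 / (δ * ms) * ((D + 4 * w) ^ 2 - D ^ 2) =
      (24576 + 384 * δ) * (w ^ 2 / (δ ^ 2 * ms)) := by
    rw [hD]
    field_simp
    ring
  have e3 : 13 / 10 * (w * D / ms) = (13 / 10 * 128 * δ) * (w ^ 2 / (δ ^ 2 * ms)) := by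
    rw [hD]
    field_simp
  rw [e1, e2, e3, ← add_mul]
  refine mul_le_mul_of_nonneg_right ?_ (by positivity)
  linarith

theorem window_cost_le {w D : ℝ} (hδ : 0 < δ) (hδ1 : δ < 1) (hms : 0 < ms) (hw : 0 ≤ w)
    (hD : 0 ≤ D) (hwD : 128 * w = δ * D) :
    13 / 10 * (w * D / ms) ≤ 24 / (δ * ms) * (D ^ 2 / 3) := by
  have : 24 / (δ * ms) * (D ^ 2 / 3) = 1024 * (w * D / ms) / δ ^ 2 := by
    rw [show D ^ 2 = D * (128 * w / δ) by rw [hwD]; field_simp]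
    field_simp
    ring
  rw [this, le_div_iff₀ (by positivity)]
  have h1 : 0 ≤ w * D / ms := by positivity
  have h2 : δ ^ 2 ≤ 1 := pow_le_one₀ hδ.le hδ1.le
  nlinarith

/-- This settles a window with small offline cost: `D ^ 2 - y ^ 2 ≥ D * (δ * w / 8)`, so the
coefficient 24 releases `3 * (w * D / ms)`, more than the window costs. -/
theorem window_cost_le_min {w D y : ℝ} (hδ : 0 < δ) (hms : 0 < ms) (hw : 0 ≤ w) (hy : 0 ≤ y)
    (hyD : y ≤ D - δ * w / 8)
    (hwA : 13 / 10 * (w * D / ms) ≤ 24 / (δ * ms) * (D ^ 2 / 3)) :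
    13 / 10 * (w * D / ms) ≤ 24 / (δ * ms) * min (D ^ 2 / 3) (D ^ 2 - y ^ 2) := by
  rcases min_choice (D ^ 2 / 3) (D ^ 2 - y ^ 2) with hc | hc <;> rw [hc]
  · exact hwA
  · have hδw : 0 ≤ δ * w := mul_nonneg hδ.le hw
    have hD : 0 ≤ D := by linarith
    have h3 : D * (δ * w / 8) ≤ D ^ 2 - y ^ 2 := by nlinarith
    have h4 := mul_le_mul_of_nonneg_left h3 (show 0 ≤ 24 / (δ * ms) by positivity)
    have h5 : 24 / (δ * ms) * (D * (δ * w / 8)) = 3 * (w * D / ms) := by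
      field_simp
      ring
    have h6 : 0 ≤ w * D / ms := by positivity
    linarith

/-! ### Amortization over windows -/

/-- The total cost of the server where it is far from the request. -/
theorem sum_farCost_le_potential (H : IsPursuit δ ms mc n p r o h) : ∀ (N t : ℕ), n - t ≤ N →
    t < n → ∑ v ∈ Finset.Ico t n, farCost (farThreshold k δ mc) p r v ≤
      farRatio k δ ms mc * ∑ v ∈ Finset.Ico t n, h v +
        potential (24 / (δ * ms)) (farThreshold k δ mc) (dist (p t) (r t)) := by
  have hms := H.speed_pos
  have hmc := hms.trans_le H.speed_le
  have hδ := H.delta_pos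
  have hδ1 := H.delta_lt
  have hk := H.servers_pos
  have hk' : (0 : ℝ) < k := Nat.cast_pos.2 hk
  have hA : 0 ≤ 24 / (δ * ms) := by positivity
  have hρ : 0 ≤ farRatio k δ ms mc := by unfold farRatio; positivity
  have hBval : δ ^ 2 * farThreshold k δ mc = 2048 * (k * mc) := by
    unfold farThreshold
    field_simp
  have hB : 2048 * mc ≤ farThreshold k δ mc := by
    unfold farThreshold
    have : mc ≤ k * mc / δ ^ 2 := by
      rw [le_div_iff₀ (by positivity)]
      exact (mul_le_of_le_one_right hmc.le (pow_le_one₀ hδ.le hδ1.le)).trans H.mc_le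
    linarith
  generalize hBdef : farThreshold k δ mc = B at *
  generalize hρdef : farRatio k δ ms mc = ρ at *
  generalize hAdef : 24 / (δ * ms) = A at *
  have hB0 : 0 ≤ B := by linarith
  have hsum : ∀ a b, 0 ≤ ρ * ∑ v ∈ Finset.Ico a b, h v := fun a b =>
    mul_nonneg hρ (Finset.sum_nonneg fun v _ => H.cost_nonneg v)
  intro N
  induction N with
  | zero => intro t h0 ht; omega
  | succ N ih =>
    intro t hN ht
    set D := dist (p t) (r t) with hDdef
    have hD0 : 0 ≤ D := dist_nonneg
    -- It suffices to find a window with a suitable cost.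
    have step : ∀ u, t < u → u < n →
        ∑ v ∈ Finset.Ico t u, farCost B p r v + potential A B (dist (p u) (r u)) ≤
          ρ * ∑ v ∈ Finset.Ico t u, h v + potential A B D →
        ∑ v ∈ Finset.Ico t n, farCost B p r v ≤
          ρ * ∑ v ∈ Finset.Ico t n, h v + potential A B D := by
      intro u htu hun hle
      have := ih u (by omega) hun
      rw [← Finset.sum_Ico_consecutive _ htu.le hun.le, ← Finset.sum_Ico_consecutive _ htu.le hun.le,
        mul_add]
      linarith
    -- The distance grows by at most `3 * mc` per step. From below this bound it stays below the
    -- truncation for one step, so neither far cost nor potential arises.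
    rcases le_or_gt D (3 / 2 * B - 3 * mc) with hsmall | hlarge
    · have hz : farCost B p r t = 0 := by
        rw [farCost, if_neg]
        linarith
      rcases (show t + 1 ≤ n from ht).eq_or_lt with heq | hlt
      · rw [← heq, Nat.Ico_succ_singleton, Finset.sum_singleton, Finset.sum_singleton, hz]
        exact add_nonneg (mul_nonneg hρ (H.cost_nonneg t)) (potential_nonneg hA _ _)
      · refine step (t + 1) (by omega) hlt ?_
        have h1 := H.dist_le_add (show t ≤ t + 1 by omega) hlt
        push_cast at h1
        rw [Nat.Ico_succ_singleton, Finset.sum_singleton, Finset.sum_singleton, hz,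
          potential_eq_zero (B := B) dist_nonneg (by linarith)]
        simpa using add_nonneg (mul_nonneg hρ (H.cost_nonneg t)) (potential_nonneg hA B D)
    · obtain ⟨w, hw⟩ : ∃ w, 128 * w = δ * D := ⟨δ * D / 128, by ring⟩
      have hDB : B ≤ D := by linarith
      -- The constant 2048 in `farThreshold` is `16 * 128`, chosen for this inequality.
      have hδw : 16 * (k * mc) ≤ δ * w := by
        have h1 : δ ^ 2 * B ≤ δ ^ 2 * D := mul_le_mul_of_nonneg_left hDB (by positivity)
        have h2 : δ * (128 * w) = δ ^ 2 * D := by rw [hw]; ring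
        linarith
      have hw0 : 0 ≤ w := by
        have := mul_nonneg hδ.le hD0
        linarith
      have hδww : δ * w ≤ w := mul_le_of_le_one_left hw0 hδ1.le
      have hmck := H.mc_le
      have hwD : 128 * w ≤ D := by
        rw [hw]; exact mul_le_of_le_one_left hD0 hδ1.le
      -- With this `Y`, the jumps `k * (2 * Y + mc)` cost at most `δ * w / 8`, half of the gain `δ *
      -- w / 4` in a window of `⌈w / ms⌉₊` steps.
      obtain ⟨Y, hYdef⟩ : ∃ Y, Y = δ * w / (32 * k) := ⟨_, rfl⟩
      have hY0 : 0 ≤ Y := by rw [hYdef]; positivity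
      have hkY : k * Y = δ * w / 32 := by
        rw [hYdef]
        field_simp
      have hYk : Y ≤ k * Y := le_mul_of_one_le_left hY0 (Nat.one_le_cast.2 hk)
      have hkYmc : k * (2 * Y + mc) ≤ δ * w / 8 := by linarith
      have hW := ceil_mul_le hw0 hms
      have hW' := le_ceil_mul (x := w) hms
      have hm := ceil_mul_le hY0 (show 0 < 4 * mc by linarith)
      have hWpos : 0 < ⌈w / ms⌉₊ := Nat.ceil_pos.2 (div_pos (by linarith) hms)
      have hNms : ((⌈w / ms⌉₊ + ⌈Y / (4 * mc)⌉₊ : ℕ) : ℝ) * ms ≤ 5 / 4 * w := by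
        have : (⌈Y / (4 * mc)⌉₊ : ℝ) * ms ≤ ⌈Y / (4 * mc)⌉₊ * mc :=
          mul_le_mul_of_nonneg_left H.speed_le (Nat.cast_nonneg _)
        have := H.speed_le
        push_cast
        linarith
      have hwindow : ∀ s, t ≤ s → s ≤ t + ⌈w / ms⌉₊ → (∀ x, t ≤ x → x < s → h x ≤ Y) →
          ∀ v, t ≤ v → v ≤ s + ⌈Y / (4 * mc)⌉₊ → v < n →
          dist (p v) (r v) ≤ D + 4 * w := fun s hts hsw hh v htv hvs hv =>
        H.dist_le_of_window hY0 (by linarith) (by linarith) (by linarith) hts hsw hh htv hvs hv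
      -- The cost of a window.
      have hcost : ∀ u, t ≤ u → u ≤ t + (⌈w / ms⌉₊ + ⌈Y / (4 * mc)⌉₊) →
          (∀ v, t ≤ v → v < u → dist (p v) (r v) ≤ D + 4 * w) →
          ∑ v ∈ Finset.Ico t u, farCost B p r v ≤ 13 / 10 * (w * D / ms) ∧
          (D ≤ 19 / 10 * B → ∑ v ∈ Finset.Ico t u, farCost B p r v = 0) := by
        intro u htu hu hE
        refine ⟨sum_farCost_le hms hw0 hwD ?_ hNms htu hE,
          fun hD => sum_farCost_eq_zero hwD hD hw0 hE⟩
        rw [sub_le_iff_le_add']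
        exact_mod_cast hu
      have hwA : 13 / 10 * (w * D / ms) ≤ A * (D ^ 2 / 3) := by
        rw [← hAdef]
        exact window_cost_le hδ hδ1 hms hw0 hD0 hw
      -- If the requests end within the window, no potential has to be kept, and the present one
      -- pays for the rest.
      have hfinal : n ≤ t + (⌈w / ms⌉₊ + ⌈Y / (4 * mc)⌉₊) →
          (∀ v, t ≤ v → v < n → dist (p v) (r v) ≤ D + 4 * w) →
          ∑ v ∈ Finset.Ico t n, farCost B p r v ≤
            ρ * ∑ v ∈ Finset.Ico t n, h v + potential A B D := by
        intro hn hE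
        obtain ⟨c1, c2⟩ := hcost n ht.le hn hE
        have := hsum t n
        rcases le_total D (19 / 10 * B) with hD | hD
        · rw [c2 hD]
          exact add_nonneg this (potential_nonneg hA _ _)
        · have := le_potential hA hB0 hD
          linarith
      -- If the offline cost exceeds `Y`, the window ends `⌈Y / (4 * mc)⌉₊` steps after the first
      -- such time, when enough offline cost has accrued. Otherwise it lasts `⌈w / ms⌉₊` steps and
      -- the server comes closer.
      by_cases hbad : ∃ s, t ≤ s ∧ s ≤ t + ⌈w / ms⌉₊ ∧ s < n ∧ Y < h s
      · classical
        obtain ⟨hts, hsw, hsn, hYs⟩ := Nat.find_spec hbad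
        have hmin : ∀ x, t ≤ x → x < Nat.find hbad → h x ≤ Y := fun x hx hxs => by
          by_contra! hlt
          exact Nat.find_min hbad hxs ⟨hx, by omega, by omega, hlt⟩
        generalize Nat.find hbad = s at *
        have hE := hwindow s hts hsw hmin
        rcases le_or_gt n (s + ⌈Y / (4 * mc)⌉₊) with hn | hn
        · exact hfinal (by omega) fun v hv hvn => hE v hv (by omega) hvn
        · have hmpos : 0 < ⌈Y / (4 * mc)⌉₊ := by
            refine Nat.ceil_pos.2 (div_pos ?_ (by linarith))
            rw [hYdef]
            have : 0 < k * mc := by positivity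
            exact div_pos (by linarith) (by positivity)
          refine step (s + ⌈Y / (4 * mc)⌉₊) (by omega) hn ?_
          have h1 := (hcost (s + ⌈Y / (4 * mc)⌉₊) (by omega) (by omega)
            fun v hv hvn => hE v hv hvn.le (by omega)).1
          have h2 := potential_le_of_le (B := B) hA dist_nonneg (hE _ (by omega) le_rfl hn)
          have h3 := potential_le_add (B := B) hA hD0 (show D ≤ D + 4 * w by linarith)
          have h4 := far_ratio_bound hk hδ hδ1 hms hmc hw hYdef
          rw [hAdef, hρdef] at h4
          have h5 := mul_le_mul_of_nonneg_left (H.mul_sq_le_sum_cost hY0 hYs.le hn.le) hρ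
          rw [← Finset.sum_Ico_consecutive h hts (show s ≤ s + ⌈Y / (4 * mc)⌉₊ by omega), mul_add]
          have h6 := hsum t s
          linarith
      · push Not at hbad
        have hgood : ∀ x, t ≤ x → x ≤ t + ⌈w / ms⌉₊ → x < n → h x ≤ Y := hbad
        rcases le_or_gt n (t + ⌈w / ms⌉₊) with hn | hn
        · exact hfinal (by omega) fun v hv hvn =>
            hwindow v hv (by omega) (fun x hx hxv => hgood x hx (by omega) (by omega)) v hv
              (by omega) hvn
        · have hE := hwindow (t + ⌈w / ms⌉₊) (by omega) le_rfl
            fun x hx hxv => hgood x hx hxv.le (by omega)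
          refine step (t + ⌈w / ms⌉₊) (by omega) hn ?_
          obtain ⟨c1, c2⟩ := hcost (t + ⌈w / ms⌉₊) (by omega) (by omega)
            fun v hv hvn => hE v hv (by omega) (by omega)
          have hgain := H.dist_le_sub hY0 (show t ≤ t + ⌈w / ms⌉₊ by omega) hn hw (by linarith)
            (by linarith) (by push_cast; linarith [H.speed_le])
            fun v hv hvu => hgood v hv hvu (by omega)
          have hle : dist (p (t + ⌈w / ms⌉₊)) (r (t + ⌈w / ms⌉₊)) ≤ D - δ * w / 8 := by
            have := mul_le_mul_of_nonneg_left hW' hδ.le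
            push_cast at hgain
            linarith
          have h0 := hsum t (t + ⌈w / ms⌉₊)
          generalize hy : dist (p (t + ⌈w / ms⌉₊)) (r (t + ⌈w / ms⌉₊)) = y at *
          have hy0 : 0 ≤ y := hy ▸ dist_nonneg
          have hδw0 : 0 ≤ δ * w := mul_nonneg hδ.le hw0
          rcases le_total D (19 / 10 * B) with hD | hD
          · rw [c2 hD]
            have := potential_le_of_le (B := B) hA hy0 (show y ≤ D by linarith)
            linarith
          · have h1 := potential_add_le hA hB0 hy0 hD
            have h2 : 13 / 10 * (w * D / ms) ≤ A * min (D ^ 2 / 3) (D ^ 2 - y ^ 2) := by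
              rw [← hAdef] at hwA ⊢
              exact window_cost_le_min hδ hms hw0 hy0 hle hwA
            linarith

/-- The two summands are what `sum_farCost_le_cost` needs: 768 for charging the initial potential, 8
for request sequences that are too short for this. -/
theorem le_farRatio (H : IsPursuit δ ms mc n p r o h) :
    768 * (mc / (δ * ms)) + 8 ≤ farRatio k δ ms mc := by
  have hms := H.speed_pos
  have hmc := hms.trans_le H.speed_le
  have hδ := H.delta_pos
  have hδ1 := H.delta_lt.le
  have hk : (1 : ℝ) ≤ k := Nat.one_le_cast.2 H.servers_pos
  have h1 : 1 ≤ mc / ms := (one_le_div hms).2 H.speed_le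
  have h2 : 1 ≤ 1 / δ := (one_le_div hδ).2 hδ1
  have h3 : (1 : ℝ) ≤ (1 / δ) ^ 3 := one_le_pow₀ h2
  have h4 : (1 : ℝ) ≤ (k : ℝ) ^ 2 := one_le_pow₀ hk
  have e1 : mc / (δ * ms) = 1 / δ * (mc / ms) := by field_simp
  have e2 : farRatio k δ ms mc =
      2 ^ 28 * (((1 / δ) ^ 3 * (k : ℝ) ^ 2) * (1 / δ * (mc / ms))) := by
    unfold farRatio
    field_simp
  have h5 : 1 ≤ 1 / δ * (mc / ms) := one_le_mul_of_one_le_of_one_le h2 h1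
  have h6 : 1 ≤ (1 / δ) ^ 3 * (k : ℝ) ^ 2 := one_le_mul_of_one_le_of_one_le h3 h4
  have h7 := le_mul_of_one_le_left (show 0 ≤ 1 / δ * (mc / ms) by linarith) h6
  rw [e1, e2]
  linarith

/-- The total cost of the server where it is far from the request, with the initial distance
charged to the offline cost. -/
theorem sum_farCost_le_cost (H : IsPursuit δ ms mc n p r o h) (hn : 0 < n) {S : ℝ} (hS : 0 ≤ S)
    (h0 : dist (p 0) (r 0) ≤ h 0 + S) :
    ∑ v ∈ Finset.range n, farCost (farThreshold k δ mc) p r v ≤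
      2 * farRatio k δ ms mc * ∑ v ∈ Finset.range n, h v + 96 / (δ * ms) * S ^ 2 := by
  have hms := H.speed_pos
  have hmc := hms.trans_le H.speed_le
  have hδ := H.delta_pos
  have hA : 0 ≤ 24 / (δ * ms) := by positivity
  have hpot : potential (24 / (δ * ms)) (farThreshold k δ mc) (dist (p 0) (r 0)) ≤
      24 / (δ * ms) * dist (p 0) (r 0) ^ 2 := by
    refine mul_le_mul_of_nonneg_left (max_le (by positivity) ?_) hA
    linarith [sq_nonneg (3 / 2 * farThreshold k δ mc)]
  have hmain := H.sum_farCost_le_potential n 0 (by omega) hn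
  simp only [← Finset.range_eq_Ico] at hmain
  have hratio := H.le_farRatio
  have hT : 0 ≤ ∑ v ∈ Finset.range n, h v := Finset.sum_nonneg fun v _ => H.cost_nonneg v
  have hmcδ : 0 ≤ mc / (δ * ms) := by positivity
  have hS2 : 0 ≤ 96 / (δ * ms) * S ^ 2 := by positivity
  have hratioT := mul_le_mul_of_nonneg_right hratio hT
  set Z := dist (p 0) (r 0) with hZ
  have hZ0 : 0 ≤ Z := dist_nonneg
  -- The first request may be arbitrarily far from the start, so the initial potential cannot simply
  -- go into the additive constant. If `Z` exceeds `2 * S`, then `h 0` is at least `Z / 2`, and the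
  -- offline cost stays above `Z / 4` for about `Z / (8 * mc)` steps.
  rcases le_or_gt Z (2 * S) with hZS | hZS
  · have h1 : 24 / (δ * ms) * Z ^ 2 ≤ 24 / (δ * ms) * (2 * S) ^ 2 := by gcongr
    have h2 : 24 / (δ * ms) * (2 * S) ^ 2 = 96 / (δ * ms) * S ^ 2 := by ring
    have h3 : 0 ≤ farRatio k δ ms mc * ∑ v ∈ Finset.range n, h v :=
      mul_nonneg (by linarith) hT
    linarith
  · have hh : ∀ t < n, (t : ℝ) * (8 * mc) ≤ Z → Z / 4 ≤ h t := fun t ht htZ => by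
      have := H.cost_sub_le (Nat.zero_le t) ht
      rw [Nat.cast_zero, sub_zero] at this
      linarith
    -- A sequence ending before that is compared step by step. A longer one makes the offline cost
    -- at least `Z ^ 2 / (32 * mc)`.
    rcases le_or_gt ((n : ℝ) * (8 * mc)) Z with hnZ | hnZ
    · have h1 : ∑ v ∈ Finset.range n, farCost (farThreshold k δ mc) p r v ≤
          8 * ∑ v ∈ Finset.range n, h v := by
        rw [Finset.mul_sum]
        refine Finset.sum_le_sum fun v hv => ?_
        rw [Finset.mem_range] at hv
        have hvn : (v : ℝ) ≤ n := Nat.cast_le.2 hv.le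
        have hvZ : (v : ℝ) * (8 * mc) ≤ Z :=
          (mul_le_mul_of_nonneg_right hvn (by linarith)).trans hnZ
        have e1 := H.dist_le_add (Nat.zero_le v) hv
        have e2 := hh v hv hvZ
        have e3 := farCost_le (farThreshold k δ mc) p r v
        rw [Nat.cast_zero, sub_zero] at e1
        linarith
      have h2 : 0 ≤ mc / (δ * ms) * ∑ v ∈ Finset.range n, h v := mul_nonneg hmcδ hT
      linarith
    · have hceil := le_ceil_mul (x := Z) (show 0 < 8 * mc by linarith)
      have hmn : ⌈Z / (8 * mc)⌉₊ ≤ n :=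
        Nat.ceil_le.2 ((div_le_iff₀ (by linarith)).2 hnZ.le)
      have hlt : ∀ j : ℕ, j < ⌈Z / (8 * mc)⌉₊ → (j : ℝ) * (8 * mc) ≤ Z := fun j hj => by
        rw [Nat.lt_ceil, lt_div_iff₀ (by linarith)] at hj
        exact hj.le
      set m := ⌈Z / (8 * mc)⌉₊
      have h1 : (m : ℝ) * (Z / 4) ≤ ∑ v ∈ Finset.range n, h v := by
        calc (m : ℝ) * (Z / 4) = ∑ v ∈ Finset.range m, Z / 4 := by simp
          _ ≤ ∑ v ∈ Finset.range m, h v := Finset.sum_le_sum fun v hv => by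
              rw [Finset.mem_range] at hv
              exact hh v (by omega) (hlt v hv)
          _ ≤ _ := Finset.sum_le_sum_of_subset_of_nonneg (Finset.range_subset_range.2 hmn)
              fun v _ _ => H.cost_nonneg v
      have h2 : Z ^ 2 ≤ 32 * mc * ∑ v ∈ Finset.range n, h v := by
        have := mul_le_mul_of_nonneg_left h1 (show 0 ≤ 32 * mc by linarith)
        nlinarith
      have h3 := mul_le_mul_of_nonneg_left h2 hA
      have h4 : 24 / (δ * ms) * (32 * mc * ∑ v ∈ Finset.range n, h v) =
          768 * (mc / (δ * ms)) * ∑ v ∈ Finset.range n, h v := by ring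
      linarith

end IsPursuit

/-! The cost of the projection. -/

section Projection

variable {d k : ℕ} {s : Config d k} (K : KServerAlgorithm d k s) {mc : ℝ} (r : ℕ → Pt d)

theorem dist_phaseStart_le (hmc : 0 ≤ mc) (t : ℕ) :
    dist (phaseStart k mc r t) (r t) ≤ 4 * k * mc := by
  have h0 : 0 ≤ 4 * (k : ℝ) * mc := by positivity
  cases t with
  | zero => simpa [phaseStart] using h0
  | succ t =>
    rw [phaseStart]
    split_ifs with h
    · simpa using h0
    · exact (not_le.1 h).le

theorem phaseStart_of_startsPhase {t : ℕ} (h : StartsPhase k mc r t) :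
    phaseStart k mc r t = r t := by
  cases t with
  | zero => rfl
  | succ t => exact if_pos h

open Classical in
theorem projection_succ_apply (t : ℕ) (i : Fin k) : K.projection mc r (t + 1) i =
    if dist (r t) (K.run r (t + 1) i) ≤ 4 * k * mc then K.run r (t + 1) i
    else if StartsPhase k mc r t then moveTowards (r t) (K.run r (t + 1) i) (4 * k * mc)
    else K.projection mc r t i := by
  rw [KServerAlgorithm.projection]

/-- A projected server that does not stay in place is in the inner circle. -/
theorem projection_succ_cases (hmc : 0 ≤ mc) (t : ℕ) (i : Fin k) :
    dist (r t) (K.projection mc r (t + 1) i) ≤ 4 * k * mc ∨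
      (¬ StartsPhase k mc r t ∧ K.projection mc r (t + 1) i = K.projection mc r t i) := by
  rw [projection_succ_apply]
  by_cases h1 : dist (r t) (K.run r (t + 1) i) ≤ 4 * k * mc
  · rw [if_pos h1]
    exact Or.inl h1
  · rw [if_neg h1]
    by_cases h2 : StartsPhase k mc r t
    · rw [if_pos h2]
      exact Or.inl (dist_moveTowards_left_le _ _ (by positivity))
    · rw [if_neg h2]
      exact Or.inr ⟨h2, rfl⟩

/-- A projected server that stays in place does so within a phase, where the reference point is
fixed as well. Any other one is within `4 * k * mc` of the request, which is within `4 * k * mc` of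
the start of the phase. -/
theorem dist_projection_phaseStart_le (hmc : 0 ≤ mc) (t : ℕ) (i : Fin k) :
    dist (K.projection mc r (t + 1) i) (phaseStart k mc r t) ≤ 8 * k * mc := by
  induction t with
  | zero =>
    rcases projection_succ_cases K r hmc 0 i with h | h
    · rw [dist_comm, phaseStart]
      have : 0 ≤ 4 * (k : ℝ) * mc := by positivity
      linarith
    · exact absurd trivial h.1
  | succ t ih =>
    rcases projection_succ_cases K r hmc (t + 1) i with h | ⟨h, he⟩
    · have h3 := dist_phaseStart_le r hmc (t + 1) (k := k)
      have h4 := dist_triangle_right (K.projection mc r (t + 1 + 1) i)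
        (phaseStart k mc r (t + 1)) (r (t + 1))
      rw [dist_comm (K.projection mc r (t + 1 + 1) i) (r (t + 1))] at h4
      linarith
    · rw [he, phaseStart, if_neg (show ¬ 4 * k * mc ≤ _ from h)]
      exact ih

theorem dist_projection_request_le (hmc : 0 ≤ mc) (t : ℕ) (i : Fin k) :
    dist (K.projection mc r (t + 1) i) (r t) ≤ 12 * k * mc := by
  have h1 := dist_projection_phaseStart_le K r hmc t i
  have h2 := dist_phaseStart_le r hmc t (k := k)
  have h3 := dist_triangle (K.projection mc r (t + 1) i) (phaseStart k mc r t) (r t)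
  linarith

/-- The distance between a projected server and the simulated one serves as a potential. -/
theorem dist_projection_step (hmc : 0 ≤ mc) (t : ℕ) (i : Fin k) :
    dist (K.projection mc r t i) (K.projection mc r (t + 1) i) +
        dist (K.projection mc r (t + 1) i) (K.run r (t + 1) i) ≤
      dist (K.projection mc r t i) (K.run r t i) + dist (K.run r t i) (K.run r (t + 1) i) +
        open Classical in
        if StartsPhase k mc r t then 2 * dist (K.projection mc r t i) (r t) else 0 := by
  have h0 : 0 ≤ 4 * (k : ℝ) * mc := by positivity
  have htri := dist_triangle (K.projection mc r t i) (K.run r t i) (K.run r (t + 1) i)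
  rw [projection_succ_apply]
  by_cases h1 : dist (r t) (K.run r (t + 1) i) ≤ 4 * k * mc
  · rw [if_pos h1, dist_self]
    split_ifs
    · have : 0 ≤ dist (K.projection mc r t i) (r t) := dist_nonneg
      linarith
    · linarith
  · rw [if_neg h1]
    split_ifs with h2
    -- The new position lies on the segment from the request to the simulated server, so the left
    -- side is at most the length of the way through the request.
    · have e1 := dist_moveTowards_left (r t) (K.run r (t + 1) i) h0
      have e2 := dist_moveTowards_right (r t) (K.run r (t + 1) i) h0
      rw [min_eq_left (not_le.1 h1).le] at e1
      have e3 := dist_triangle (K.projection mc r t i) (r t)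
        (moveTowards (r t) (K.run r (t + 1) i) (4 * k * mc))
      have e4 := dist_triangle_left (r t) (K.run r (t + 1) i) (K.projection mc r t i)
      linarith
    · rw [dist_self]
      linarith

/-! ### Charging the changes of phase -/

/-- The number of phases that start after the first request and up to the request `r n`. -/
def phaseCount {d : ℕ} (k : ℕ) (mc : ℝ) (r : ℕ → Pt d) (n : ℕ) : ℕ :=
  open Classical in ((Finset.range n).filter fun t => StartsPhase k mc r (t + 1)).card

theorem phaseCount_succ (n : ℕ) : phaseCount k mc r (n + 1) = phaseCount k mc r n +
    open Classical in if StartsPhase k mc r (n + 1) then 1 else 0 := by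
  classical
  unfold phaseCount
  rw [Finset.range_add_one, Finset.filter_insert]
  split_ifs with h
  · rw [Finset.card_insert_of_notMem (by simp)]
  · rfl

theorem moveCost_succ (x : ℕ → Config d k) (n : ℕ) :
    moveCost x (n + 1) = moveCost x n + ∑ i, dist (x n i) (x (n + 1) i) :=
  Finset.sum_range_succ _ _

/-- The potential of `dist_projection_step` telescopes. At a later change of phase each of the `k`
servers is within `12 * k * mc + mc` of the new request, whence `26 = 2 * 13`. The first phase is
kept apart because the initial servers need not be near `r 0`. -/
theorem moveCost_projection_le (hmc : 0 ≤ mc) {n : ℕ}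
    (hr : IsLocal mc r (n + 1)) :
    moveCost (K.projection mc r) (n + 1) ≤ moveCost (K.run r) (n + 1) +
      2 * ∑ i, dist (s i) (r 0) + 26 * (k : ℝ) * (k * mc) * phaseCount k mc r n := by
  have hrun : K.run r 0 = s := by simp [KServerAlgorithm.run, K.config_nil]
  suffices h : moveCost (K.projection mc r) (n + 1) +
      ∑ i, dist (K.projection mc r (n + 1) i) (K.run r (n + 1) i) ≤ moveCost (K.run r) (n + 1) +
      2 * ∑ i, dist (s i) (r 0) + 26 * (k : ℝ) * (k * mc) * phaseCount k mc r n by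
    have : 0 ≤ ∑ i, dist (K.projection mc r (n + 1) i) (K.run r (n + 1) i) :=
      Finset.sum_nonneg fun _ _ => dist_nonneg
    linarith
  have hstep := fun t => Finset.sum_le_sum fun i (_ : i ∈ Finset.univ) =>
    dist_projection_step K r hmc t i
  simp only [Finset.sum_add_distrib] at hstep
  induction n with
  | zero =>
    have := hstep 0
    simp only [if_pos (show StartsPhase k mc r 0 from trivial), ← Finset.mul_sum,
      KServerAlgorithm.projection.eq_1, hrun, dist_self, Finset.sum_const_zero] at this
    simpa [moveCost, phaseCount, hrun, KServerAlgorithm.projection.eq_1] using this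
  | succ n ih =>
    have ih := ih fun t ht => hr t (by omega)
    have h1 := hstep (n + 1)
    have h2 : (∑ i, open Classical in if StartsPhase k mc r (n + 1) then
        2 * dist (K.projection mc r (n + 1) i) (r (n + 1)) else 0) ≤
        26 * (k : ℝ) * (k * mc) * (open Classical in if StartsPhase k mc r (n + 1) then 1 else 0) := by
      split_ifs
      · refine (Finset.sum_le_card_nsmul _ _ (26 * (k * mc)) fun i _ => ?_).trans_eq ?_
        · have e1 := dist_projection_request_le K r hmc n i
          have e2 := hr n (by omega)
          have e3 := dist_triangle (K.projection mc r (n + 1) i) (r n) (r (n + 1))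
          have e4 : mc ≤ k * mc := le_mul_of_one_le_left hmc (Nat.one_le_cast.2 i.pos)
          linarith
        · rw [Finset.card_univ, Fintype.card_fin, nsmul_eq_mul]
          ring
      · simp
    rw [phaseCount_succ, moveCost_succ, moveCost_succ (K.run r)]
    push_cast
    linarith

/-- Every phase costs the offline solution at least `3 * k * mc`, up to constant factors. -/
theorem phaseCount_mul_le {n : ℕ} {o : ℕ → Config d k} {h : ℕ → ℝ} (hmc : 0 ≤ mc)
    (hh : ∀ t, 0 ≤ h t) (hser : ∀ t, ∃ i, dist (o t i) (r t) ≤ h t) (hr : IsLocal mc r (n + 1)) :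
    3 * k * mc * phaseCount k mc r n ≤
      ∑ t ∈ Finset.range n, ∑ i, dist (o t i) (o (t + 1) i) +
        4 * ∑ t ∈ Finset.range (n + 1), h t := by
  -- Here `τ` is the start of the current phase. Its cost `h τ` is used by the phases on both sides,
  -- so `2 * h τ` is held in reserve for the next one.
  suffices H : ∃ τ ≤ n, phaseStart k mc r n = r τ ∧
      3 * k * mc * phaseCount k mc r n + 2 * h τ ≤
        ∑ t ∈ Finset.range τ, ∑ i, dist (o t i) (o (t + 1) i) +
        4 * ∑ t ∈ Finset.range (τ + 1), h t by
    obtain ⟨τ, hτ, -, hle⟩ := H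
    have h1 : ∑ t ∈ Finset.range τ, ∑ i, dist (o t i) (o (t + 1) i) ≤
        ∑ t ∈ Finset.range n, ∑ i, dist (o t i) (o (t + 1) i) :=
      Finset.sum_le_sum_of_subset_of_nonneg (Finset.range_subset_range.2 hτ)
        fun _ _ _ => Finset.sum_nonneg fun _ _ => dist_nonneg
    have h2 : ∑ t ∈ Finset.range (τ + 1), h t ≤ ∑ t ∈ Finset.range (n + 1), h t :=
      Finset.sum_le_sum_of_subset_of_nonneg (Finset.range_subset_range.2 (by omega))
        fun t _ _ => hh t
    linarith [hh τ]
  induction n with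
  | zero =>
    refine ⟨0, le_rfl, rfl, ?_⟩
    have := hh 0
    simp [phaseCount]
    linarith
  | succ n ih =>
    obtain ⟨τ, hτ, hp, hle⟩ := ih fun t ht => hr t (by omega)
    by_cases hs : StartsPhase k mc r (n + 1)
    · refine ⟨n + 1, le_rfl, phaseStart_of_startsPhase r hs, ?_⟩
      have h1 : 4 * k * mc ≤ dist (r τ) (r (n + 1)) := by
        rw [← hp]
        exact hs
      have h2 := dist_request_le_cost (o := o) hmc hh hr Finset.univ τ (n + 1) (by omega) (by omega)
        fun u _ _ => by simpa using hser u
      rw [Finset.card_univ, Fintype.card_fin] at h2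
      have h3 := Finset.sum_range_add_sum_Ico (fun t => ∑ i, dist (o t i) (o (t + 1) i))
        (show τ ≤ n + 1 by omega)
      have h4 := Finset.sum_range_add_sum_Ico h (show τ + 1 ≤ n + 1 + 1 by omega)
      have h5 := Finset.sum_eq_sum_Ico_succ_bot (show τ < n + 1 + 1 by omega) h
      have h6 := Finset.single_le_sum (f := h) (fun u _ => hh u)
        (Finset.mem_Ico.2 ⟨by omega, by omega⟩ : n + 1 ∈ Finset.Ico (τ + 1) (n + 1 + 1))
      rw [phaseCount_succ, if_pos hs]
      push_cast
      linarith
    · refine ⟨τ, by omega, ?_, ?_⟩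
      · rw [phaseStart, if_neg (show ¬ 4 * k * mc ≤ _ from hs), hp]
      · rw [phaseCount_succ, if_neg hs]
        exact hle

end Projection

/-! ### The matching weight as a potential -/

section Matching

variable {d k : ℕ}

/-- The minimum weight of a perfect matching between two configurations. -/
def matchingWeight (a c : Config d k) : ℝ :=
  ⨅ σ : Equiv.Perm (Fin k), ∑ j, dist (a j) (c (σ j))

theorem matchingWeight_nonneg (a c : Config d k) : 0 ≤ matchingWeight a c :=
  Real.iInf_nonneg fun _ => Finset.sum_nonneg fun _ _ => dist_nonneg

theorem matchingWeight_le (a c : Config d k) (σ : Equiv.Perm (Fin k)) :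
    matchingWeight a c ≤ ∑ j, dist (a j) (c (σ j)) :=
  ciInf_le (Set.finite_range _).bddBelow σ

theorem IsMinMatching.matchingWeight_eq {a c : Config d k} {σ : Equiv.Perm (Fin k)}
    (h : IsMinMatching a c σ) : matchingWeight a c = ∑ j, dist (a j) (c (σ j)) :=
  le_antisymm (matchingWeight_le a c σ) (le_ciInf h)

theorem matchingWeight_self (a : Config d k) : matchingWeight a a = 0 :=
  le_antisymm ((matchingWeight_le a a 1).trans_eq (by simp)) (matchingWeight_nonneg a a)

theorem matchingWeight_le_add (a c c' : Config d k) :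
    matchingWeight a c' ≤ matchingWeight a c + ∑ j, dist (c j) (c' j) := by
  obtain ⟨σ, hσ⟩ : ∃ σ : Equiv.Perm (Fin k), ∑ j, dist (a j) (c (σ j)) = matchingWeight a c :=
    exists_eq_ciInf_of_finite
  refine (matchingWeight_le a c' σ).trans ?_
  rw [← hσ, ← Equiv.sum_comp σ fun j => dist (c j) (c' j), ← Finset.sum_add_distrib]
  exact Finset.sum_le_sum fun j _ => dist_triangle _ _ _

variable {δ ms : ℝ} {a c a' : Config d k} {p : Pt d}

/-- Every server of UMS moves towards the request or a simulated server. -/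
theorem IsUMSStep.exists_target (h : IsUMSStep δ ms a c p a') (hδ : 0 < δ) (hδ1 : δ < 1)
    (hms : 0 < ms) (j : Fin k) : ∃ q l, (q = p ∨ ∃ i, q = c i) ∧ (1 + δ / 2) * ms ≤ l ∧
      l ≤ 2 * ms ∧ a' j = moveTowards (a j) q l := by
  have h1 : (1 + δ / 2) * ms ≤ (1 + δ) * ms := mul_le_mul_of_nonneg_right (by linarith) hms.le
  have h2 : (1 + δ) * ms ≤ 2 * ms := mul_le_mul_of_nonneg_right (by linarith) hms.le
  obtain ⟨σ, -, i, -, ⟨-, hm⟩ | ⟨-, b, -, hb, hm⟩⟩ := h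
  · exact ⟨_, _, Or.inr ⟨_, rfl⟩, h1, h2, hm j⟩
  · by_cases hj : j = b
    · subst hj
      exact ⟨_, _, Or.inl rfl, le_rfl, h1.trans h2, hb⟩
    · exact ⟨_, _, Or.inr ⟨_, rfl⟩, h1, h2, hm j hj⟩

/-- In every step, UMS serves the request at cost zero or decreases the weight of the matching
substantially; the decrease also pays for the movement. -/
theorem IsUMSStep.matchingWeight_add_le (h : IsUMSStep δ ms a c p a') (hδ : 0 < δ) (hδ1 : δ < 1)
    (hms : 0 < ms) :
    ((∃ i, a' i = p) ∧ matchingWeight a' c + δ / 8 * ∑ j, dist (a j) (a' j) ≤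
      matchingWeight a c) ∨
    matchingWeight a' c + δ / 8 * ∑ j, dist (a j) (a' j) + δ / 16 * ms ≤ matchingWeight a c := by
  have hl : 0 ≤ (1 + δ) * ms := by positivity
  have hl' : 0 ≤ (1 + δ / 2) * ms := by positivity
  obtain ⟨σ, hσ, i, hi, h⟩ := h
  have hw := matchingWeight_le a' c σ
  rw [hσ.matchingWeight_eq]
  set g : Fin k → ℝ := fun j =>
    dist (a j) (c (σ j)) - dist (a' j) (c (σ j)) - δ / 8 * dist (a j) (a' j) with hg
  have hsum : ∑ j, g j = ∑ j, dist (a j) (c (σ j)) - ∑ j, dist (a' j) (c (σ j)) -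
      δ / 8 * ∑ j, dist (a j) (a' j) := by
    simp only [hg, Finset.sum_sub_distrib, Finset.mul_sum]
  have hgain : ∀ j l, 0 ≤ l → a' j = moveTowards (a j) (c (σ j)) l →
      g j = (1 - δ / 8) * dist (a j) (a' j) := by
    intro j l hl hj
    have := dist_moveTowards_right (a j) (c (σ j)) hl
    rw [← hj] at this
    simp only [hg]
    linarith
  have hnn : ∀ j, 0 ≤ (1 - δ / 8) * dist (a j) (a' j) := fun j =>
    mul_nonneg (by linarith) dist_nonneg
  rcases h with ⟨hip, hm⟩ | ⟨hip, b, -, hb, hm⟩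
  · refine Or.inl ⟨⟨i, ?_⟩, ?_⟩
    · rw [hm i, hi, moveTowards, if_pos hip]
    · have : 0 ≤ ∑ j, g j := Finset.sum_nonneg fun j _ => by
        rw [hgain j _ hl (hm j)]
        exact hnn j
      linarith
  · refine Or.inr ?_
    suffices hS : δ / 16 * ms ≤ ∑ j, g j by linarith
    have hgj : ∀ j, j ≠ b → 0 ≤ g j := fun j hj => by
      rw [hgain j _ hl (hm j hj)]
      exact hnn j
    rw [← Finset.add_sum_erase _ _ (Finset.mem_univ b)]
    have hlt : (1 + δ / 2) * ms ≤ (1 + δ) * ms := mul_le_mul_of_nonneg_right (by linarith) hms.le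
    have hδms : 0 ≤ δ * ms := by positivity
    by_cases hib : i = b
    · subst hib
      have h1 : g i = (1 - δ / 8) * ((1 + δ / 2) * ms) := by
        rw [hgain i _ hl' (by rw [hi]; exact hb), hb, dist_moveTowards_left _ _ hl',
          min_eq_left (hlt.trans hip.le)]
      have h2 : 0 ≤ ∑ j ∈ Finset.univ.erase i, g j :=
        Finset.sum_nonneg fun j hj => hgj j (Finset.ne_of_mem_erase hj)
      nlinarith
    -- The matched server `i` is too far to arrive and gains at full speed, while `b` may move away
    -- from its counterpart but only at speed `(1 + δ / 2) * ms`. The difference is at least `δ / 4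
    -- * ms - 3 / 16 * δ ^ 2 * ms`, hence at least `δ / 16 * ms`.
    · have h1 : g i = (1 - δ / 8) * ((1 + δ) * ms) := by
        rw [hgain i _ hl (hm i hib), hm i hib, dist_moveTowards_left _ _ hl, hi,
          min_eq_left hip.le]
      have h2 : g i ≤ ∑ j ∈ Finset.univ.erase b, g j :=
        Finset.single_le_sum (fun j hj => hgj j (Finset.ne_of_mem_erase hj))
          (Finset.mem_erase.2 ⟨hib, Finset.mem_univ i⟩)
      have h3 : -((1 + δ / 8) * ((1 + δ / 2) * ms)) ≤ g b := by
        have e1 := dist_moveTowards_left_le (a b) p hl'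
        rw [← hb] at e1
        have e2 := dist_triangle_left (a' b) (c (σ b)) (a b)
        have e3 := mul_le_mul_of_nonneg_left e1 (show 0 ≤ 1 + δ / 8 by linarith)
        simp only [hg]
        linarith
      have h4 : δ * (δ * ms) ≤ δ * ms := mul_le_of_le_one_left hδms hδ1.le
      nlinarith

end Matching

/-! ### The cost of a run against the offline cost -/

section Run

variable {d k : ℕ} {s : Config d k} {K : KServerAlgorithm d k s} {δ ms mc : ℝ} {r : ℕ → Pt d}
  {n : ℕ} {a o : ℕ → Config d k}

/-- The cost of UMS in terms of the movement of the simulated servers, the number `N` of steps in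
which the request is not reached, and the cost where a fixed server is far from the request. -/
theorem IsUMSRun.exists_cost_le (h : IsUMSRun K δ ms mc r n a) (hδ : 0 < δ) (hδ1 : δ < 1)
    (hms : 0 < ms) {B : ℝ} (hB : 0 ≤ B) (j : Fin k) : ∃ N : ℝ, 0 ≤ N ∧
      δ / 8 * moveCost a n + δ / 16 * ms * N ≤ moveCost (K.projection mc r) n ∧
      ∑ t ∈ Finset.range n, ⨅ i, dist (a (t + 1) i) (r t) ≤
        2 * B * N + ∑ t ∈ Finset.range n, IsPursuit.farCost B (fun t => a (t + 1) j) r t := by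
  suffices H : ∀ m ≤ n, ∃ N : ℝ, 0 ≤ N ∧
      matchingWeight (a m) (K.projection mc r m) + δ / 8 * moveCost a m + δ / 16 * ms * N ≤
        moveCost (K.projection mc r) m ∧
      ∑ t ∈ Finset.range m, ⨅ i, dist (a (t + 1) i) (r t) ≤
        2 * B * N + ∑ t ∈ Finset.range m, IsPursuit.farCost B (fun t => a (t + 1) j) r t by
    obtain ⟨N, h0, h1, h2⟩ := H n le_rfl
    exact ⟨N, h0, by linarith [matchingWeight_nonneg (a n) (K.projection mc r n)], h2⟩
  intro m
  induction m with
  | zero =>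
    intro _
    refine ⟨0, le_rfl, ?_, by simp⟩
    rw [h.1, KServerAlgorithm.projection, matchingWeight_self]
    simp [moveCost]
  | succ m ih =>
    intro hm
    obtain ⟨N, h0, h1, h2⟩ := ih (by omega)
    have h3 := matchingWeight_le_add (a m) (K.projection mc r m) (K.projection mc r (m + 1))
    have hbdd : BddBelow (Set.range fun i => dist (a (m + 1) i) (r m)) :=
      (Set.finite_range _).bddBelow
    simp only [moveCost_succ, Finset.sum_range_succ]
    rcases (h.2 m hm).matchingWeight_add_le hδ hδ1 hms with ⟨⟨i, hi⟩, h4⟩ | h4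
    · refine ⟨N, h0, by linarith, ?_⟩
      have h5 := ciInf_le hbdd i
      rw [hi, dist_self] at h5
      linarith [IsPursuit.farCost_nonneg B (fun t => a (t + 1) j) r m]
    -- A missed request is charged to the fixed server `j`, which need not be the closest one.
    · refine ⟨N + 1, by linarith, by linarith, ?_⟩
      have h5 : dist (a (m + 1) j) (r m) ≤
          2 * B + IsPursuit.farCost B (fun t => a (t + 1) j) r m := by
        unfold IsPursuit.farCost
        split_ifs with hc
        · linarith
        · linarith [not_lt.1 hc]
      have h6 := ciInf_le hbdd j
      linarith

/-- A server of UMS pursues the requests. -/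
theorem IsUMSRun.isPursuit (h : IsUMSRun K δ ms mc r n a) (hr : IsLocal mc r n)
    (ho : IsMobileSolution ms s o n) (hδ : 0 < δ) (hδ1 : δ < 1) (hms : 0 < ms) (hmc : ms ≤ mc)
    (j : Fin k) : IsPursuit δ ms mc n (fun t => a (t + 1) j) r (fun t => o (t + 1))
      (fun t => ⨅ i, dist (o (t + 1) i) (r t)) where
  servers_pos := j.pos
  delta_pos := hδ
  delta_lt := hδ1
  speed_pos := hms
  speed_le := hmc
  request_step := hr
  -- Time `t` of the pursuit is the configuration after step `t`, hence the shift by one.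
  offline_step t ht i := ho.2 (t + 1) ht i
  cost_eq _ := rfl
  chase t ht := by
    obtain ⟨q, l, hq, h1, h2, h3⟩ := (h.2 (t + 1) ht).exists_target hδ hδ1 hms j
    refine ⟨q, l, ?_, h1, h2, h3⟩
    rcases hq with rfl | ⟨i, rfl⟩
    · rw [dist_self]
      have := hms.trans_le hmc
      positivity
    · exact dist_projection_request_le K r (hms.le.trans hmc) (t + 1) i

theorem mobileCost_one_eq (x : ℕ → Config d k) (r : ℕ → Pt d) (n : ℕ) : mobileCost 1 x r n =
    moveCost x n + ∑ t ∈ Finset.range n, ⨅ i, dist (x (t + 1) i) (r t) := by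
  simp only [mobileCost, moveCost, one_mul, Finset.sum_add_distrib]

theorem moveCost_nonneg (x : ℕ → Config d k) (n : ℕ) : 0 ≤ moveCost x n :=
  Finset.sum_nonneg fun _ _ => Finset.sum_nonneg fun _ _ => dist_nonneg

/-- A solution of the mobile server problem yields a `k`-server solution of at most twice the
cost. -/
theorem exists_kServerSolution (hk : 0 < k) (ho : o 0 = s) : ∃ x : ℕ → Config d k,
    IsKServerSolution s x r n ∧ moveCost x n ≤ 2 * mobileCost 1 o r n := by
  classical
  have := Fin.pos_iff_nonempty.1 hk
  have hmin : ∀ t, ∃ i, dist (o (t + 1) i) (r t) = ⨅ i, dist (o (t + 1) i) (r t) :=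
    fun t => exists_eq_ciInf_of_finite
  choose i hi using hmin
  let x : ℕ → Config d k := fun t => Nat.casesOn t s fun t => Function.update (o (t + 1)) (i t) (r t)
  have hx : ∀ t, x (t + 1) = Function.update (o (t + 1)) (i t) (r t) := fun _ => rfl
  refine ⟨x, ⟨rfl, fun t _ => ⟨i t, by rw [hx, Function.update_self]⟩⟩, ?_⟩
  have hdist : ∀ t, ∑ j, dist (o (t + 1) j) (x (t + 1) j) = ⨅ i, dist (o (t + 1) i) (r t) := by
    intro t
    rw [Finset.sum_eq_single (i t), hx, Function.update_self, hi]
    · intro j _ hj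
      rw [hx, Function.update_of_ne hj, dist_self]
    · simp
  -- The gap between `o` and `x` serves as a potential. Each detour onto a request is paid on the
  -- way out and on the way back, which gives the factor 2.
  suffices H : ∀ m, moveCost x m + ∑ j, dist (o m j) (x m j) ≤
      moveCost o m + 2 * ∑ t ∈ Finset.range m, ⨅ i, dist (o (t + 1) i) (r t) by
    have h1 := H n
    have h2 : 0 ≤ ∑ j, dist (o n j) (x n j) := Finset.sum_nonneg fun _ _ => dist_nonneg
    have h3 := moveCost_nonneg o n
    rw [mobileCost_one_eq]
    linarith
  intro m
  induction m with
  | zero => simp [moveCost, ho, x]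
  | succ m ih =>
    have h1 : ∑ j, dist (x m j) (x (m + 1) j) ≤ ∑ j, (dist (o m j) (x m j) +
        dist (o m j) (o (m + 1) j) + dist (o (m + 1) j) (x (m + 1) j)) :=
      Finset.sum_le_sum fun j _ => by
        rw [dist_comm (o m j) (x m j)]
        exact dist_triangle4 _ _ _ _
    rw [Finset.sum_add_distrib, Finset.sum_add_distrib, hdist] at h1
    rw [moveCost_succ, moveCost_succ, Finset.sum_range_succ, hdist]
    linarith

/-- The movement of the projected servers in terms of the offline cost. -/
theorem moveCost_projection_le_mobileCost (hk : 0 < k) (hmc : 0 ≤ mc) {c β S : ℝ}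
    (hc : 0 ≤ c) (hK : ∀ (n : ℕ) (r : ℕ → Pt d) (x : ℕ → Config d k), IsKServerSolution s x r n →
      moveCost (K.run r) n ≤ c * moveCost x n + β)
    (hS : ∀ i j, dist (s i) (s j) ≤ S) (hn : 0 < n) (hr : IsLocal mc r n)
    (ho : IsMobileSolution ms s o n) :
    (∀ i, dist (s i) (r 0) ≤ (⨅ i, dist (o 1 i) (r 0)) + (S + ms)) ∧
    moveCost (K.projection mc r) n ≤
      (2 * c + 37 * k) * mobileCost 1 o r n + (β + 2 * k * (S + ms)) := by
  have := Fin.pos_iff_nonempty.1 hk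
  obtain ⟨n, rfl⟩ : ∃ m, n = m + 1 := ⟨n - 1, by omega⟩
  set h : ℕ → ℝ := fun t => ⨅ i, dist (o (t + 1) i) (r t) with hdef
  have hh : ∀ t, 0 ≤ h t := fun t => Real.iInf_nonneg fun _ => dist_nonneg
  have hmin : ∀ t, ∃ i, dist (o (t + 1) i) (r t) = h t := fun t => exists_eq_ciInf_of_finite
  have hstart : ∀ i, dist (s i) (r 0) ≤ h 0 + (S + ms) := by
    intro i
    obtain ⟨j, hj⟩ := hmin 0
    have h1 := ho.2 0 hn j
    rw [ho.1] at h1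
    have h2 := dist_triangle4 (s i) (s j) (o 1 j) (r 0)
    have h3 := hS i j
    simp only [zero_add] at hj h1
    linarith
  refine ⟨hstart, ?_⟩
  obtain ⟨x, hx, hxc⟩ := exists_kServerSolution (n := n + 1) (r := r) hk ho.1
  have h1 := hK _ _ _ hx
  have h2 := moveCost_projection_le K r hmc hr
  have h3 := phaseCount_mul_le (o := fun t => o (t + 1)) (k := k) r hmc hh
    (fun t => (hmin t).imp fun _ => le_of_eq) hr
  have h4 : ∑ t ∈ Finset.range n, ∑ i, dist (o (t + 1) i) (o (t + 1 + 1) i) ≤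
      moveCost o (n + 1) := by
    rw [moveCost, Finset.sum_range_succ']
    exact le_add_of_nonneg_right (Finset.sum_nonneg fun _ _ => dist_nonneg)
  have hopt := mobileCost_one_eq o r (n + 1)
  have h5 := moveCost_nonneg o (n + 1)
  have h6 := Finset.single_le_sum (f := h) (fun u _ => hh u)
    (Finset.mem_range.2 hn : 0 ∈ Finset.range (n + 1))
  change _ = _ + ∑ t ∈ Finset.range (n + 1), h t at hopt
  set Opt := mobileCost 1 o r (n + 1)
  have h7 : ∑ i, dist (s i) (r 0) ≤ k * (Opt + (S + ms)) := by
    refine (Finset.sum_le_card_nsmul _ _ (Opt + (S + ms)) fun i _ => ?_).trans_eq ?_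
    · linarith [hstart i]
    · rw [Finset.card_univ, Fintype.card_fin, nsmul_eq_mul]
  have h8 := mul_le_mul_of_nonneg_left hxc hc
  -- The coefficient 37 covers `26 * (4 / 3)` from the phases and 2 from the first request.
  have h9 : k * mc * phaseCount k mc r n ≤ 4 / 3 * Opt := by linarith
  have h10 := mul_le_mul_of_nonneg_left h9 (show 0 ≤ 26 * (k : ℝ) by positivity)
  have h11 : 0 ≤ Opt := by linarith [hh 0]
  have h12 : 0 ≤ k * Opt := mul_nonneg (Nat.cast_nonneg k) h11
  linarith

end Run

/-! ### The constants and the competitive ratio -/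

/-- The factor between the cost of UMS and the movement of the projected servers. -/
theorem movement_factor_le {k : ℕ} {δ ms mc : ℝ} (hk : 0 < k) (hδ : 0 < δ) (hδ1 : δ < 1)
    (hms : 0 < ms) (hmc : ms ≤ mc) :
    8 / δ + 32 * IsPursuit.farThreshold k δ mc / (δ * ms) ≤
      65544 * (1 / δ ^ 3 * (k : ℝ) * (mc / ms)) := by
  have hk' : (1 : ℝ) ≤ k := Nat.one_le_cast.2 hk
  have h1 : 1 ≤ mc / ms := (one_le_div hms).2 hmc
  have h2 : 1 ≤ 1 / δ := (one_le_div hδ).2 hδ1.le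
  have h3 : 1 ≤ (1 / δ) ^ 2 * ((k : ℝ) * (mc / ms)) :=
    one_le_mul_of_one_le_of_one_le (one_le_pow₀ h2) (one_le_mul_of_one_le_of_one_le hk' h1)
  have h4 := le_mul_of_one_le_right (show 0 ≤ 1 / δ by linarith) h3
  have e1 : 32 * IsPursuit.farThreshold k δ mc / (δ * ms) =
      65536 * (1 / δ ^ 3 * (k : ℝ) * (mc / ms)) := by
    unfold IsPursuit.farThreshold
    field_simp
    ring
  have e2 : 1 / δ * ((1 / δ) ^ 2 * ((k : ℝ) * (mc / ms))) = 1 / δ ^ 3 * (k : ℝ) * (mc / ms) := by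
    field_simp
  have e3 : 8 / δ = 8 * (1 / δ) := by ring
  rw [e2] at h4
  rw [e1, e3]
  linarith

/-- The far cost, `2 * farRatio`, gives the `1 / δ ^ 4` term and uses half of the constant `2 ^ 30`.
The projection's `37 * k` contributes only order `1 / δ ^ 3` and fits into the remaining half; its
`2 * c` goes to the second summand. -/
theorem ratio_le {k : ℕ} {δ ms mc c : ℝ} (hk : 0 < k) (hδ : 0 < δ) (hδ1 : δ < 1)
    (hms : 0 < ms) (hmc : 0 < mc) (hc : 0 ≤ c) :
    65544 * (1 / δ ^ 3 * (k : ℝ) * (mc / ms)) * (2 * c + 37 * k) +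
        2 * IsPursuit.farRatio k δ ms mc ≤
      2 ^ 30 * (1 / δ ^ 4 * (k : ℝ) ^ 2 * (mc / ms)
        + 1 / δ ^ 3 * (k : ℝ) ^ 2 * (mc / ms) * c) := by
  have hk' : (1 : ℝ) ≤ k := Nat.one_le_cast.2 hk
  have h2 : 1 ≤ 1 / δ := (one_le_div hδ).2 hδ1.le
  have hX : 0 ≤ 1 / δ ^ 3 * (k : ℝ) * (mc / ms) := by positivity
  have e1 : 1 / δ ^ 3 * (k : ℝ) ^ 2 * (mc / ms) = 1 / δ ^ 3 * (k : ℝ) * (mc / ms) * k := by ring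
  have e2 : 1 / δ ^ 4 * (k : ℝ) ^ 2 * (mc / ms) =
      1 / δ ^ 3 * (k : ℝ) * (mc / ms) * k * (1 / δ) := by
    field_simp
  unfold IsPursuit.farRatio
  rw [e2, e1]
  set X := 1 / δ ^ 3 * (k : ℝ) * (mc / ms)
  have h3 : X * k ≤ X * k * (1 / δ) := le_mul_of_one_le_right (by positivity) h2
  have h4 : X * c ≤ X * k * c :=
    mul_le_mul_of_nonneg_right (le_mul_of_one_le_right hX hk') hc
  have h5 : 0 ≤ X * k * c := by positivity
  have h6 : 0 ≤ X * k := by positivity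
  linarith

end MobileServer

end

theorem mainTheorem1 :
    ∃ C : ℝ, 0 < C ∧
      ∀ (d k : ℕ) (δ ms mc c : ℝ) (s : MobileServer.Config d k)
        (K : MobileServer.KServerAlgorithm d k s),
        0 < k → 0 < δ → δ < 1 → 0 < ms → (1 + δ) * ms ≤ mc → 0 ≤ c → K.IsCompetitive c →
          MobileServer.UMSIsCompetitive K δ ms mc
            (C * (1 / δ ^ 4 * (k : ℝ) ^ 2 * (mc / ms)
              + 1 / δ ^ 3 * (k : ℝ) ^ 2 * (mc / ms) * c)) := by
  open MobileServer IsPursuit in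
  refine ⟨2 ^ 30, by positivity, fun d k δ ms mc c s K hk hδ hδ1 hms hmc' hc ⟨β, hK⟩ => ?_⟩
  have hmc : ms ≤ mc := (le_mul_of_one_le_left hms.le (by linarith)).trans hmc'
  have hmc0 : 0 < mc := hms.trans_le hmc
  obtain ⟨S, hS0, hS⟩ : ∃ S : ℝ, 0 ≤ S ∧ ∀ i j, dist (s i) (s j) ≤ S := by
    obtain ⟨S, hS⟩ := (Set.finite_range fun x : Fin k × Fin k => dist (s x.1) (s x.2)).bddAbove
    exact ⟨max S 0, le_max_right _ _, fun i j => (hS ⟨(i, j), rfl⟩).trans (le_max_left _ _)⟩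
  set B := farThreshold k δ mc with hBdef
  have hB : 0 ≤ B := by
    rw [hBdef, farThreshold]
    positivity
  set U := 8 / δ + 32 * B / (δ * ms) with hU
  have hU0 : 0 ≤ U := by positivity
  have hβ₀ : 0 ≤ |β| + 2 * k * (S + ms) := by positivity
  have hβ₁ : 0 ≤ 96 / (δ * ms) * (S + 3 * ms) ^ 2 := by positivity
  -- The additive constant depends on the diameter bound `S` of the start, not on its distance to `r
  -- 0`. The absolute value keeps it nonnegative, as the empty sequence requires.
  refine ⟨U * (|β| + 2 * k * (S + ms)) + 96 / (δ * ms) * (S + 3 * ms) ^ 2, ?_⟩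
  intro n r hr a ha o ho
  rcases n.eq_zero_or_pos with rfl | hn
  · simp only [mobileCost, Finset.range_zero, Finset.sum_empty, mul_zero, zero_add]
    positivity
  obtain ⟨hstart, hproj⟩ := moveCost_projection_le_mobileCost hk hmc0.le hc hK hS hn hr ho
  have hP := ha.isPursuit hr ho hδ hδ1 hms hmc ⟨0, hk⟩
  -- One `ms` comes from the first offline step and `2 * ms` from the first step of UMS.
  have hinit : dist (a (0 + 1) ⟨0, hk⟩) (r 0) ≤
      (⨅ i, dist (o (0 + 1) i) (r 0)) + (S + 3 * ms) := by
    obtain ⟨q, l, -, h1, h2, h3⟩ := (ha.2 0 hn).exists_target hδ hδ1 hms ⟨0, hk⟩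
    have h4 := dist_moveTowards_left_le (a 0 ⟨0, hk⟩) q
      (le_trans (by positivity) h1 : 0 ≤ l)
    rw [← h3, ha.1] at h4
    have h5 := dist_triangle_left (a (0 + 1) ⟨0, hk⟩) (r 0) (s ⟨0, hk⟩)
    have h6 := hstart ⟨0, hk⟩
    simp only [zero_add] at *
    linarith
  have hfar := hP.sum_farCost_le_cost hn (by positivity) hinit
  obtain ⟨N, hN0, hN, hserve⟩ := ha.exists_cost_le hδ hδ1 hms hB ⟨0, hk⟩
  have hopt := mobileCost_one_eq o r n
  have hmove := moveCost_nonneg o n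
  have hmove' := moveCost_nonneg a n
  have hsv : 0 ≤ ∑ t ∈ Finset.range n, ⨅ i, dist (o (t + 1) i) (r t) :=
    Finset.sum_nonneg fun t _ => hP.cost_nonneg t
  set Opt := mobileCost 1 o r n
  rw [mobileCost_one_eq a]
  have hOpt : 0 ≤ Opt := by linarith
  have hM : moveCost a n + 2 * B * N ≤ U * moveCost (K.projection mc r) n := by
    have h1 : moveCost a n ≤ 8 / δ * moveCost (K.projection mc r) n := by
      rw [div_mul_eq_mul_div, le_div_iff₀ hδ]
      have : 0 ≤ δ / 16 * ms * N := by positivity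
      linarith
    have h2 : N ≤ 16 / (δ * ms) * moveCost (K.projection mc r) n := by
      rw [div_mul_eq_mul_div, le_div_iff₀ (by positivity)]
      have : 0 ≤ δ / 8 * moveCost a n := by positivity
      linarith
    have h3 := mul_le_mul_of_nonneg_left h2 (show 0 ≤ 2 * B by linarith)
    have h4 : 2 * B * (16 / (δ * ms) * moveCost (K.projection mc r) n) =
        32 * B / (δ * ms) * moveCost (K.projection mc r) n := by ring
    rw [hU, add_mul]
    linarith
  have hproj' : moveCost (K.projection mc r) n ≤
      (2 * c + 37 * k) * Opt + (|β| + 2 * k * (S + ms)) := by linarith [le_abs_self β]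
  have h1 := mul_le_mul_of_nonneg_left hproj' hU0
  have h2 := mul_le_mul_of_nonneg_right (movement_factor_le hk hδ hδ1 hms hmc)
    (show 0 ≤ (2 * c + 37 * k) * Opt by positivity)
  have h3 := mul_le_mul_of_nonneg_right (ratio_le hk hδ hδ1 hms hmc0 hc) hOpt
  have h4 : 2 * farRatio k δ ms mc * ∑ t ∈ Finset.range n, ⨅ i, dist (o (t + 1) i) (r t) ≤
      2 * farRatio k δ ms mc * Opt := by
    refine mul_le_mul_of_nonneg_left (by linarith) ?_
    unfold farRatio
    positivity
  rw [← hBdef, ← hU] at h2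
  linarith
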